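/- Let $X_1,X_2,\ldots$ be independent random variables with $\mathbb P(X_j=1)=\mathbb P(X_j=-1)=1/2$, and let $Z_i=\sum_{k=1}^i\prod_{j=1}^k X_j$ for $i\ge 0$ (the switch random walk). For $j\ge 1$ let $(N_j(t))_{t\ge 0}$ be Poisson processes of rate $1$, and for $j\ge1$, $m\ge 0$ let $X_j^m$ be random variables with $\mathbb P(X_j^m=1)=\mathbb P(X_j^m=-1)=1/2$, all the $N_j$ and $X_j^m$ being independent. Put $X_j(t)=X_j^m$ whenever $N_j(t)=m$, and let $Z_i(t)=\sum_{k=1}^i\prod_{j=1}^k X_j(t)$ (the dynamical switch random walk). For $\alpha\ge 0$, $n\in\mathbb N$ and $t\ge 0$ define the events \[P^\alpha_n=\{Z_i\ge i^\alpha\ \text{ for all } i=1,\ldots,n\},\qquad P^\alpha_n(t)=\{Z_i(t)\ge i^\alpha\ \text{ for all } i=1,\ldots,n\},\] and for $\gamma\in[0,1)$ define the normalised energy \[\Phi^\alpha_n(\gamma)=\frac{1}{\mathbb P(P^\alpha_n)^{2}}\int_0^1\!\int_0^1 \frac{\mathbf 1_{P^\alpha_n(s)\cap P^\alpha_n(t)}}{|t-s|^{\gamma}}\,ds\,dt.\]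 Then, for all $\alpha,\gamma\in[0,1/2)$, the $\Phi^\alpha_n(\gamma)$ are (almost everywhere equal to) $[0,\infty]$-valued random variables and \[\sup_{n}\mathbb E[\Phi^\alpha_n(\gamma)]<\infty.\] -/

import Mathlib

open MeasureTheory ProbabilityTheory
open scoped NNReal ENNReal

noncomputable section

namespace SwitchWalk

/-- The switch random walk driven by the bits `x`: `Z_n = ∑_{k=1}^n ∏_{j=1}^k x_j`.
The bits are enumerated from `0`, so the Lean term `x j` is the bit with number `j + 1`. -/
def walk (x : ℕ → ℤ) (n : ℕ) : ℤ :=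
  ∑ k ∈ Finset.range n, ∏ j ∈ Finset.range (k + 1), x j

variable {Ω : Type*} [MeasurableSpace Ω]

/-- `ξ` is a random variable with `P(ξ = 1) = P(ξ = -1) = 1/2`. -/
structure IsFairSign (ξ : Ω → ℤ) (P : Measure Ω) : Prop where
  measurable : Measurable ξ
  prob_one : P {ω | ξ ω = 1} = 1 / 2
  prob_neg_one : P {ω | ξ ω = -1} = 1 / 2

/-- `N` is a Poisson process of rate `1`: a counting process (almost surely started from `0`,
with nondecreasing right-continuous paths) with independent increments such that
`N t - N s` has the Poisson distribution of mean `t - s` for `s ≤ t`. -/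
structure IsPoissonProcess (N : ℝ≥0 → Ω → ℕ) (P : Measure Ω) : Prop where
  measurable : ∀ t, Measurable (N t)
  start : ∀ᵐ ω ∂P, N 0 ω = 0
  monotone : ∀ᵐ ω ∂P, Monotone fun t => N t ω
  rightCont : ∀ᵐ ω ∂P, ∀ t, ContinuousWithinAt (fun s => N s ω) (Set.Ici t) t
  indep : HasIndepIncrements N P
  law : ∀ s t : ℝ≥0, s ≤ t → P.map (fun ω => N t ω - N s ω) = poissonMeasure (t - s)

/-- `X 0, X 1, …` are independent fair signs. -/
structure IsFairSignSequence (X : ℕ → Ω → ℤ) (P : Measure Ω) : Prop where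
  sign : ∀ j, IsFairSign (X j) P
  indep : iIndepFun X P

/-- The randomness behind the dynamical walk: Poisson processes `N j` of rate `1` and fair signs
`ξ j i` (the value of the bit `j` after its `i`-th rerandomisation), all of them independent.
The σ-algebra of `N j` is the one generated by the whole process `(N j t)_{t ≥ 0}`. -/
structure IsDynamics (N : ℕ → ℝ≥0 → Ω → ℕ) (ξ : ℕ → ℕ → Ω → ℤ) (P : Measure Ω) : Prop where
  poisson : ∀ j, IsPoissonProcess (N j) P
  sign : ∀ j i, IsFairSign (ξ j i) P
  indep : iIndep
    (Sum.elim
      (fun j : ℕ => MeasurableSpace.comap (fun ω t => N j t ω) inferInstance)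
      (fun p : ℕ × ℕ => MeasurableSpace.comap (ξ p.1 p.2) inferInstance)) P

/-- The dynamical bits: `X_j(t) = ξ_j^i` whenever `N_j(t) = i`. -/
def bit (N : ℕ → ℝ≥0 → Ω → ℕ) (ξ : ℕ → ℕ → Ω → ℤ) (j : ℕ) (t : ℝ≥0) (ω : Ω) : ℤ :=
  ξ j (N j t ω) ω

/-- The event that the switch walk driven by the random bits `X` satisfies `Z_i ≥ i ^ α` for all
`i = 1, …, n`. -/
def aboveEvent (α : ℝ) (n : ℕ) (X : ℕ → Ω → ℤ) : Set Ω :=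
  {ω | ∀ i : ℕ, 1 ≤ i → i ≤ n → (i : ℝ) ^ α ≤ (walk (fun j => X j ω) i : ℝ)}

/-- The event `P^α_n(t)`: the dynamical walk satisfies `Z_i(t) ≥ i ^ α` for all `i = 1, …, n`. -/
def dynAboveEvent (α : ℝ) (n : ℕ) (N : ℕ → ℝ≥0 → Ω → ℕ) (ξ : ℕ → ℕ → Ω → ℤ) (t : ℝ≥0) : Set Ω :=
  aboveEvent α n (fun j => bit N ξ j t)

/-- The normalised energy `Φ^α_n(γ)`, as a `[0, ∞]`-valued function on `Ω`. The static bits `X`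
enter only through the normalising constant `P(P^α_n)`. -/
def energy (α γ : ℝ) (n : ℕ) (X : ℕ → Ω → ℤ) (N : ℕ → ℝ≥0 → Ω → ℕ) (ξ : ℕ → ℕ → Ω → ℤ)
    (P : Measure Ω) (ω : Ω) : ℝ≥0∞ :=
  1 / P (aboveEvent α n X) ^ 2 *
    ∫⁻ t in Set.Icc (0 : ℝ) 1, ∫⁻ s in Set.Icc (0 : ℝ) 1,
      (dynAboveEvent α n N ξ s.toNNReal ∩ dynAboveEvent α n N ξ t.toNNReal).indicator 1 ω /
        ENNReal.ofReal |t - s| ^ γ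

end SwitchWalk

end

/-! The proof is a second moment estimate. By Tonelli the expected energy is the double integral
over `[0,1]²` of `P(P_n(s) ∩ P_n(t)) / |t - s|^γ`, divided by `P(P_n)²`. It therefore suffices to
have `P(P_n) ≥ c / √(n+1)` and `P(P_n(s) ∩ P_n(t)) ≤ C / (√|t-s| (n+1))`: the factors `n+1` cancel,
and `|v|^(-(γ+1/2))` is integrable near `0` because `γ < 1/2`.

Upper bound (`pairWalk_survive_le`). The curve is weakened to positivity. The walks at times `s` and
`t` form a pair of simple walks that moves in parallel or antiparallel and changes mode with
probability `q = (1 - e^{-|t-s|})/2` per step. A superharmonic majorant of the product of the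
positions shows that the expected product on survival is `O(1/√q)`. Surviving walks typically have
both positions of order `√n`, so survival has probability `O(1/(√q n))`.

Lower bound (`exists_le_timedWalk_survive`). A static switch walk is a simple random walk. Started
high enough at `(m, m)`, it keeps mean at least `m/2` on survival, since the total push of the curve
`i^α` is summable for `α < 1/2`. Its second moment on survival is `O(√n)`, so survival has
probability at least of order `1/√n`.

Both bounds are proved for powers of killed transition operators; `measure_orbit` turns them into
probabilities. -/

namespace SwitchWalk

/-! ### Killed transition operators. -/

section Killed

variable {S S' E E' : Type*} [Fintype E] [Fintype E']

/-- The one-step operator of the chain with transitions `x ↦ step x e` of weight `p e`, killed when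
it leaves `D`. -/
noncomputable def killed (p : E → ℝ) (step : S → E → S) (D : Set S) : Module.End ℝ (S → ℝ) where
  toFun φ x := ∑ e, p e * D.indicator φ (step x e)
  map_add' φ ψ := by
    ext x
    simp only [Pi.add_apply, ← Finset.sum_add_distrib]
    refine Finset.sum_congr rfl fun e _ => ?_
    by_cases h : step x e ∈ D <;> simp [h]; ring
  map_smul' c φ := by
    ext x
    simp only [Pi.smul_apply, smul_eq_mul, RingHom.id_apply, Finset.mul_sum]
    refine Finset.sum_congr rfl fun e _ => ?_
    by_cases h : step x e ∈ D <;> simp [h]; ring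

variable {p : E → ℝ} {step : S → E → S} {D D' : Set S} {φ ψ : S → ℝ}

theorem killed_apply (x : S) :
    killed p step D φ x = ∑ e, p e * D.indicator φ (step x e) := rfl

theorem killed_pow_succ_apply (n : ℕ) (x : S) :
    (killed p step D ^ (n + 1)) φ x = killed p step D ((killed p step D ^ n) φ) x := by
  rw [pow_succ']; rfl

theorem killed_pow_succ_apply' (n : ℕ) (x : S) :
    (killed p step D ^ (n + 1)) φ x = (killed p step D ^ n) (killed p step D φ) x := by
  rw [pow_succ]; rfl

theorem killed_mono (hp : ∀ e, 0 ≤ p e) (hD : D ⊆ D') (h : ∀ x ∈ D, φ x ≤ ψ x)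
    (h0 : ∀ x ∈ D', x ∉ D → 0 ≤ ψ x) (x : S) :
    killed p step D φ x ≤ killed p step D' ψ x := by
  refine Finset.sum_le_sum fun e _ => mul_le_mul_of_nonneg_left ?_ (hp e)
  by_cases h1 : step x e ∈ D
  · simpa [h1, hD h1] using h _ h1
  · by_cases h2 : step x e ∈ D'
    · simpa [h1, h2] using h0 _ h2 h1
    · simp [h1, h2]

theorem killed_nonneg (hp : ∀ e, 0 ≤ p e) (h : ∀ x ∈ D, 0 ≤ φ x) (x : S) :
    0 ≤ killed p step D φ x :=
  Finset.sum_nonneg fun e _ => mul_nonneg (hp e) (Set.indicator_nonneg h _)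

theorem killed_pow_nonneg (hp : ∀ e, 0 ≤ p e) (h : ∀ x, 0 ≤ φ x) (n : ℕ) (x : S) :
    0 ≤ (killed p step D ^ n) φ x := by
  induction n generalizing x with
  | zero => simpa using h x
  | succ n ih => rw [killed_pow_succ_apply]; exact killed_nonneg hp (fun x _ => ih x) x

theorem killed_pow_mono (hp : ∀ e, 0 ≤ p e) (h : ∀ x, φ x ≤ ψ x) (n : ℕ) (x : S) :
    (killed p step D ^ n) φ x ≤ (killed p step D ^ n) ψ x := by
  induction n generalizing x with
  | zero => simpa using h x
  | succ n ih =>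
    simp only [killed_pow_succ_apply]
    exact killed_mono hp subset_rfl (fun x _ => ih x) (fun x h h' => absurd h h') x

theorem killed_pow_mono_on (hp : ∀ e, 0 ≤ p e) (h : ∀ x ∈ D, φ x ≤ ψ x) (n : ℕ) {x : S}
    (hx : x ∈ D) :
    (killed p step D ^ n) φ x ≤ (killed p step D ^ n) ψ x := by
  induction n generalizing x with
  | zero => simpa using h x hx
  | succ n ih =>
    simp only [killed_pow_succ_apply]
    exact killed_mono hp subset_rfl (fun x hx => ih hx) (fun x h h' => absurd h h') x

theorem killed_pow_mono_set (hp : ∀ e, 0 ≤ p e) (hD : D ⊆ D') (h : ∀ x, 0 ≤ φ x) (n : ℕ) (x : S) :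
    (killed p step D ^ n) φ x ≤ (killed p step D' ^ n) φ x := by
  induction n generalizing x with
  | zero => simp
  | succ n ih =>
    simp only [killed_pow_succ_apply]
    exact killed_mono hp hD (fun x _ => ih x) (fun x _ _ => killed_pow_nonneg hp h n x) x

theorem killed_pow_le_of_superharmonic (hp : ∀ e, 0 ≤ p e) (h : ∀ x ∈ D, φ x ≤ ψ x)
    (hψ : ∀ x ∈ D, killed p step D ψ x ≤ ψ x) (n : ℕ) {x : S} (hx : x ∈ D) :
    (killed p step D ^ n) φ x ≤ ψ x := by
  induction n generalizing x with
  | zero => simpa using h x hx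
  | succ n ih =>
    simp only [killed_pow_succ_apply]
    exact (killed_mono hp subset_rfl (fun x hx => ih hx) (fun x h h' => absurd h h') x).trans
      (hψ x hx)

theorem killed_one_le (hp : ∀ e, 0 ≤ p e) (hp1 : ∑ e, p e = 1) (x : S) :
    killed p step D 1 x ≤ 1 := by
  rw [killed_apply, ← hp1]
  refine Finset.sum_le_sum fun e _ => mul_le_of_le_one_right (hp e) ?_
  exact Set.indicator_le_self' (by simp) _ |>.trans (by simp)

theorem killed_pow_one_le (hp : ∀ e, 0 ≤ p e) (hp1 : ∑ e, p e = 1) (n : ℕ) (x : S) :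
    (killed p step D ^ n) 1 x ≤ 1 := by
  induction n generalizing x with
  | zero => simp
  | succ n ih =>
    rw [killed_pow_succ_apply]
    exact (killed_mono hp subset_rfl (ψ := 1) (fun x _ => ih x) (fun x h h' => absurd h h') x).trans
      (killed_one_le hp hp1 x)

/-- The induction step of the survival bounds. `φ` covers typical end points and `χ` atypically low
ones. By the Markov property the last `k` steps make `χ` small uniformly in the position at time `n
- k`, while survival up to that time is kept as a factor. -/
theorem killed_pow_one_le_of_split (hp : ∀ e, 0 ≤ p e) {χ : S → ℝ} {n k : ℕ} (hk : k ≤ n)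
    {x : S} (hx : x ∈ D) {B δ : ℝ} (h : ∀ y ∈ D, 1 ≤ φ y + χ y)
    (hφ : (killed p step D ^ n) φ x ≤ B) (hχ : ∀ y, (killed p step D ^ k) χ y ≤ δ) :
    (killed p step D ^ n) 1 x ≤ B + δ * (killed p step D ^ (n - k)) 1 x := by
  have h1 : (killed p step D ^ n) 1 x ≤ (killed p step D ^ n) (φ + χ) x :=
    killed_pow_mono_on hp h n hx
  have h2 : (killed p step D ^ n) χ x ≤ δ * (killed p step D ^ (n - k)) 1 x := by
    have h3 : (killed p step D ^ n) χ = (killed p step D ^ (n - k)) ((killed p step D ^ k) χ) := by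
      rw [← Module.End.mul_apply, ← pow_add, Nat.sub_add_cancel hk]
    have h4 : (killed p step D ^ (n - k)) (δ • (1 : S → ℝ)) x =
        δ * (killed p step D ^ (n - k)) 1 x := by
      rw [map_smul]; rfl
    rw [h3, ← h4]
    exact killed_pow_mono hp (fun y => by simpa using hχ y) _ x
  rw [map_add, Pi.add_apply] at h1
  linarith

theorem killed_pow_one_antitone (hp : ∀ e, 0 ≤ p e) (hp1 : ∑ e, p e = 1) (x : S) :
    Antitone fun n => (killed p step D ^ n) 1 x :=
  antitone_nat_of_succ_le fun n => by
    rw [killed_pow_succ_apply']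
    exact killed_pow_mono hp (fun x => killed_one_le hp hp1 x) n x

/-- If the law of `π (step x e)` depends on `π x` only, killed operators descend along `π`. -/
theorem killed_pow_comp {p' : E' → ℝ} {step' : S' → E' → S'} {D' : Set S'} {π : S → S'}
    (hD : D = π ⁻¹' D')
    (hπ : ∀ (φ : S' → ℝ) (x : S),
      ∑ e, p e * φ (π (step x e)) = ∑ e, p' e * φ (step' (π x) e))
    (φ : S' → ℝ) (n : ℕ) (x : S) :
    (killed p step D ^ n) (φ ∘ π) x = (killed p' step' D' ^ n) φ (π x) := by
  induction n generalizing φ with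
  | zero => simp
  | succ n ih =>
    rw [killed_pow_succ_apply', killed_pow_succ_apply', ← ih]
    refine congrFun (congrArg _ (funext fun x => ?_)) x
    simp only [killed_apply, Function.comp_apply, ← hπ, hD]
    rfl

end Killed

/-! ### From killed operators to probabilities. -/

section Orbit

variable {S E : Type*}

/-- The orbit of `x` under the steps `e 0, e 1, …`. -/
def orbit (step : S → E → S) (x : S) (e : ℕ → E) : ℕ → S
  | 0 => x
  | n + 1 => step (orbit step x e n) (e n)

variable {Ω : Type*} [MeasurableSpace Ω] {P : Measure Ω} [MeasurableSpace E]

/-- The σ-algebra generated by the variables with index less than `n`. -/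
abbrev past (ζ : ℕ → Ω → E) (n : ℕ) : MeasurableSpace Ω :=
  ⨆ j ∈ Set.Iio n, MeasurableSpace.comap (ζ j) inferInstance

theorem past_mono {Ω : Type*} (ζ : ℕ → Ω → E) {m n : ℕ} (h : m ≤ n) : past ζ m ≤ past ζ n :=
  biSup_mono fun _ hj => lt_of_lt_of_le hj h

variable [Fintype E] [MeasurableSingletonClass E]

theorem measurableSet_orbit_mem {Ω : Type*} (step : S → E → S) (x : S) (ζ : ℕ → Ω → E) (n : ℕ) (A : Set S) :
    MeasurableSet[past ζ n] {ω | orbit step x (fun j => ζ j ω) n ∈ A} := by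
  induction n generalizing A with
  | zero => exact @MeasurableSet.const _ (past ζ 0) (x ∈ A)
  | succ n ih =>
    have : {ω | orbit step x (fun j => ζ j ω) (n + 1) ∈ A} =
        ⋃ e, (ζ n ⁻¹' {e} ∩ {ω | orbit step x (fun j => ζ j ω) n ∈ {y | step y e ∈ A}}) := by
      ext ω
      simp [orbit]
    rw [this]
    refine MeasurableSet.iUnion fun e => MeasurableSet.inter ?_ ?_
    · have h : MeasurableSpace.comap (ζ n) inferInstance ≤ past ζ (n + 1) :=
        le_biSup (fun j => MeasurableSpace.comap (ζ j) inferInstance) (Set.mem_Iio.2 n.lt_succ_self)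
      exact h _ ⟨{e}, measurableSet_singleton e, rfl⟩
    · exact past_mono ζ n.le_succ _ (ih _)

/-- The last step is independent of `past ζ n`, so averaging over its finitely many values peels off
one application of `killed`. Survival is required only from time `1` on, so the starting point may
lie outside `D`. -/
theorem lintegral_orbit {p : E → ℝ} (hp : ∀ e, 0 ≤ p e) (step : S → E → S) (D : Set S)
    {ζ : ℕ → Ω → E} (hζ : ∀ n, Measurable (ζ n))
    (hind : ∀ n, Indep (past ζ n) (MeasurableSpace.comap (ζ n) inferInstance) P)
    (hlaw : ∀ n e, P (ζ n ⁻¹' {e}) = ENNReal.ofReal (p e))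
    [IsProbabilityMeasure P] (x : S) (n : ℕ) {φ : S → ℝ} (hφ : ∀ x, 0 ≤ φ x) :
    ∫⁻ ω, {ω | ∀ i, 1 ≤ i → i ≤ n → orbit step x (fun j => ζ j ω) i ∈ D}.indicator
        (fun ω => ENNReal.ofReal (φ (orbit step x (fun j => ζ j ω) n))) ω ∂P =
      ENNReal.ofReal ((killed p step D ^ n) φ x) := by
  have hpast : ∀ n, past ζ n ≤ ‹MeasurableSpace Ω› := fun n =>
    iSup₂_le fun j _ => (hζ j).comap_le
  induction n generalizing φ with
  | zero =>
    have : {ω : Ω | ∀ i, 1 ≤ i → i ≤ 0 → orbit step x (fun j => ζ j ω) i ∈ D} = Set.univ :=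
      Set.eq_univ_of_forall fun ω i h1 h2 => by omega
    rw [this]
    simp [orbit]
  | succ n ih =>
    rw [killed_pow_succ_apply', ← ih (fun x => killed_nonneg hp (fun x _ => hφ x) x)]
    set A : Set Ω := {ω | ∀ i, 1 ≤ i → i ≤ n → orbit step x (fun j => ζ j ω) i ∈ D} with hA
    set o : Ω → S := fun ω => orbit step x (fun j => ζ j ω) n with ho
    have hAm : MeasurableSet[past ζ n] A := by
      have : A = ⋂ i ∈ Set.Icc 1 n, {ω | orbit step x (fun j => ζ j ω) i ∈ D} := by
        ext ω; simp [hA]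
      rw [this]
      exact MeasurableSet.biInter (Set.to_countable _) fun i hi =>
        past_mono ζ hi.2 _ (measurableSet_orbit_mem step x ζ i D)
    have hg : ∀ g : S → ℝ≥0∞, Measurable[past ζ n] (A.indicator fun ω => g (o ω)) := by
      intro g
      refine Measurable.indicator ?_ hAm
      intro B _
      exact measurableSet_orbit_mem step x ζ n (g ⁻¹' B)
    have key : ∀ e, ∫⁻ ω, (ζ n ⁻¹' {e}).indicator 1 ω *
        A.indicator (fun ω => ENNReal.ofReal (D.indicator φ (step (o ω) e))) ω ∂P =
        ENNReal.ofReal (p e) *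
          ∫⁻ ω, A.indicator (fun ω => ENNReal.ofReal (D.indicator φ (step (o ω) e))) ω ∂P := by
      intro e
      rw [lintegral_mul_eq_lintegral_mul_lintegral_of_independent_measurableSpace
        (hζ n).comap_le (hpast n) (hind n).symm ?_
        (hg fun y => ENNReal.ofReal (D.indicator φ (step y e)))]
      · rw [lintegral_indicator_one (hζ n (measurableSet_singleton e)), hlaw]
      · exact measurable_const.indicator ⟨{e}, measurableSet_singleton e, rfl⟩
    calc _ = ∫⁻ ω, ∑ e, (ζ n ⁻¹' {e}).indicator 1 ω *
          A.indicator (fun ω => ENNReal.ofReal (D.indicator φ (step (o ω) e))) ω ∂P := by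
          congr 1
          ext ω
          rw [Finset.sum_eq_single (ζ n ω)]
          · have h1 : ω ∈ {ω | ∀ i, 1 ≤ i → i ≤ n + 1 → orbit step x (fun j => ζ j ω) i ∈ D} ↔
                ω ∈ A ∧ step (o ω) (ζ n ω) ∈ D := by
              constructor
              · intro h
                exact ⟨fun i h1 h2 => h i h1 (by omega), h (n + 1) (by omega) le_rfl⟩
              · rintro ⟨h1, h2⟩ i hi1 hi2
                rcases hi2.lt_or_eq with h | rfl
                · exact h1 i hi1 (by omega)
                · exact h2
            by_cases hω : ω ∈ A <;> by_cases hs : step (o ω) (ζ n ω) ∈ D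
            · rw [Set.indicator_of_mem (h1.2 ⟨hω, hs⟩)]; simp [hω, hs]; rfl
            · rw [Set.indicator_of_notMem (fun h => hs (h1.1 h).2)]; simp [Set.indicator, hs]
            · rw [Set.indicator_of_notMem (fun h => hω (h1.1 h).1)]; simp [hω]
            · rw [Set.indicator_of_notMem (fun h => hs (h1.1 h).2)]; simp [Set.indicator, hs]
          · intro e _ he
            simp [he.symm]
          · simp
      _ = ∑ e, ENNReal.ofReal (p e) *
          ∫⁻ ω, A.indicator (fun ω => ENNReal.ofReal (D.indicator φ (step (o ω) e))) ω ∂P := by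
          rw [lintegral_finsetSum]
          · exact Finset.sum_congr rfl fun e _ => key e
          · intro e _
            exact (measurable_one.indicator (hζ n (measurableSet_singleton e))).mul
              ((hg fun y => ENNReal.ofReal (D.indicator φ (step y e))).mono (hpast n) le_rfl)
      _ = _ := by
          simp_rw [← lintegral_const_mul' _ _ ENNReal.ofReal_ne_top]
          rw [← lintegral_finsetSum]
          · congr 1
            ext ω
            by_cases hω : ω ∈ A
            · simp only [hω, Set.indicator_of_mem, killed_apply]
              rw [ENNReal.ofReal_sum_of_nonneg]
              · simp_rw [ENNReal.ofReal_mul (hp _)]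
                rfl
              · exact fun e _ => mul_nonneg (hp e) (Set.indicator_nonneg (fun x _ => hφ x) _)
            · simp [hω]
          · intro e _
            exact ((hg fun y => ENNReal.ofReal (D.indicator φ (step y e))).mono
              (hpast n) le_rfl).const_mul _

/-- The probability of staying in `D` for `n` steps is given by the killed operator. -/
theorem measure_orbit {p : E → ℝ} (hp : ∀ e, 0 ≤ p e) (step : S → E → S) (D : Set S)
    {ζ : ℕ → Ω → E} (hζ : ∀ n, Measurable (ζ n))
    (hind : ∀ n, Indep (past ζ n) (MeasurableSpace.comap (ζ n) inferInstance) P)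
    (hlaw : ∀ n e, P (ζ n ⁻¹' {e}) = ENNReal.ofReal (p e))
    [IsProbabilityMeasure P] (x : S) (n : ℕ) :
    P {ω | ∀ i, 1 ≤ i → i ≤ n → orbit step x (fun j => ζ j ω) i ∈ D} =
      ENNReal.ofReal ((killed p step D ^ n) 1 x) := by
  rw [← lintegral_orbit (φ := 1) hp step D hζ hind hlaw x n (fun _ => zero_le_one)]
  simp only [Pi.one_apply, ENNReal.ofReal_one]
  refine (lintegral_indicator_one ?_).symm
  have : {ω | ∀ i, 1 ≤ i → i ≤ n → orbit step x (fun j => ζ j ω) i ∈ D} =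
      ⋂ i ∈ Set.Icc 1 n, {ω | orbit step x (fun j => ζ j ω) i ∈ D} := by
    ext ω; simp
  rw [this]
  exact MeasurableSet.biInter (Set.to_countable _) fun i _ =>
    (iSup₂_le fun j _ => (hζ j).comap_le : past ζ i ≤ _) _ (measurableSet_orbit_mem step x ζ i D)

end Orbit

/-! ### Simple random walk on the half line. -/

section SimpleWalk

theorem sum_intUnits (f : ℤˣ → ℝ) : ∑ y, f y = f 1 + f (-1) := by
  rw [UnitsInt.univ, Finset.sum_pair (by decide)]

/-- The step of the simple random walk. -/
def srwStep (z : ℤ) (y : ℤˣ) : ℤ := z + y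

/-- The simple random walk on `ℤ` killed outside `D`. -/
noncomputable abbrev srw (D : Set ℤ) : Module.End ℝ (ℤ → ℝ) :=
  killed (fun _ : ℤˣ => (1 / 2 : ℝ)) srwStep D

theorem sum_half : ∑ _y : ℤˣ, (1 / 2 : ℝ) = 1 := by
  rw [sum_intUnits]; norm_num

theorem half_nonneg : ∀ _y : ℤˣ, (0 : ℝ) ≤ 1 / 2 := fun _ => by norm_num

theorem srw_apply (D : Set ℤ) (φ : ℤ → ℝ) (z : ℤ) :
    srw D φ z = (D.indicator φ (z + 1) + D.indicator φ (z - 1)) / 2 := by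
  rw [killed_apply, sum_intUnits]
  simp only [srwStep, Units.val_one, Units.val_neg, ← sub_eq_add_neg]
  ring

/-- The shift by `a` of functions on `ℤ`. -/
def shift (a : ℤ) : Module.End ℝ (ℤ → ℝ) where
  toFun φ z := φ (z + a)
  map_add' _ _ := rfl
  map_smul' _ _ := rfl

theorem shift_pow_apply (a : ℤ) (n : ℕ) (φ : ℤ → ℝ) (z : ℤ) :
    (shift a ^ n) φ z = φ (z + n * a) := by
  induction n generalizing z with
  | zero => simp
  | succ n ih =>
    rw [pow_succ', Module.End.mul_apply]
    change (shift a ^ n) φ (z + a) = _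
    rw [ih]
    push_cast
    ring_nf

theorem srw_univ_eq : srw Set.univ = (1 / 2 : ℝ) • (shift 1 + shift (-1)) := by
  ext φ z
  rw [srw_apply]
  simp only [Set.indicator_univ, LinearMap.smul_apply, LinearMap.add_apply, Pi.smul_apply,
    Pi.add_apply, smul_eq_mul]
  change _ = 1 / 2 * (φ (z + 1) + φ (z + -1))
  rw [← sub_eq_add_neg]
  ring

theorem srw_univ_pow_apply (n : ℕ) (φ : ℤ → ℝ) (z : ℤ) :
    (srw Set.univ ^ n) φ z =
      ∑ j ∈ Finset.range (n + 1), (n.choose j / 2 ^ n : ℝ) * φ (z + j - (n - j : ℕ)) := by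
  have hcomm : Commute (shift 1) (shift (-1)) := by
    ext φ z
    change φ (z + 1 + -1) = φ (z + -1 + 1)
    ring_nf
  rw [srw_univ_eq, smul_pow, hcomm.add_pow, LinearMap.smul_apply, LinearMap.sum_apply]
  simp only [Pi.smul_apply, Finset.sum_apply, smul_eq_mul, Finset.mul_sum]
  refine Finset.sum_congr rfl fun j _ => ?_
  rw [(Nat.cast_commute (n.choose j) _).symm.eq, ← nsmul_eq_mul, LinearMap.smul_apply,
    Pi.smul_apply, Module.End.mul_apply, shift_pow_apply, shift_pow_apply, nsmul_eq_mul, one_div,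
    inv_pow]
  have : z + j * 1 + ((n - j : ℕ) : ℤ) * -1 = z + j - (n - j : ℕ) := by ring
  rw [this]
  ring

/-- The recursion `(m+1) C_{m+1} = 2(2m+1) C_m` reduces the induction to `(2m+3)(2m+1) ≤ 4(m+1)²`.
-/
theorem centralBinom_sq_le (m : ℕ) : (2 * m + 1) * m.centralBinom ^ 2 ≤ 16 ^ m := by
  induction m with
  | zero => simp
  | succ m ih =>
    have h := Nat.succ_mul_centralBinom_succ m
    have h1 : (m + 1) ^ 2 * ((2 * (m + 1) + 1) * (m + 1).centralBinom ^ 2) =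
        4 * (2 * m + 3) * (2 * m + 1) * ((2 * m + 1) * m.centralBinom ^ 2) := by
      calc _ = (2 * m + 3) * ((m + 1) * (m + 1).centralBinom) ^ 2 := by ring
        _ = _ := by rw [h]; ring
    have h2 : (m + 1) ^ 2 * ((2 * (m + 1) + 1) * (m + 1).centralBinom ^ 2) ≤
        (m + 1) ^ 2 * 16 ^ (m + 1) := by
      rw [h1]
      calc _ ≤ 4 * (2 * m + 3) * (2 * m + 1) * 16 ^ m := by gcongr
        _ ≤ 16 * (m + 1) ^ 2 * 16 ^ m := Nat.mul_le_mul_right _ (by nlinarith)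
        _ = _ := by ring
    exact Nat.le_of_mul_le_mul_left h2 (by positivity)

theorem choose_div_le (m j : ℕ) : ((2 * m).choose j : ℝ) / 2 ^ (2 * m) ≤ 1 / √(2 * m + 1) := by
  have h1 : ((2 * m).choose j : ℝ) ≤ m.centralBinom := by
    exact_mod_cast Nat.choose_le_centralBinom j m
  have h2 : (2 * m + 1 : ℝ) * (m.centralBinom : ℝ) ^ 2 ≤ 16 ^ m := by
    exact_mod_cast centralBinom_sq_le m
  rw [div_le_div_iff₀ (by positivity) (by positivity), one_mul]
  refine abs_le_of_sq_le_sq' ?_ (by positivity) |>.2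
  rw [mul_pow, Real.sq_sqrt (by positivity)]
  calc _ ≤ (m.centralBinom : ℝ) ^ 2 * (2 * m + 1) := by gcongr
    _ ≤ 16 ^ m := by linarith
    _ = _ := by rw [← pow_mul, mul_comm, ← mul_assoc, pow_mul]; norm_num

/-- Concentration bound for the simple random walk. -/
theorem srw_univ_pow_indicator_le (m : ℕ) {a : ℝ} (ha : 0 < a) (z : ℤ) :
    (srw Set.univ ^ (2 * m)) ({x : ℤ | 0 < x ∧ (x : ℝ) < a}.indicator 1) z ≤
      a / √(2 * m + 1) := by
  rw [srw_univ_pow_apply]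
  set g : ℕ → ℤ := fun j => z + j - (2 * m - j : ℕ) with hg
  set s := (Finset.range (2 * m + 1)).filter fun j => 0 < g j ∧ (g j : ℝ) < a with hs
  -- The end point determines the number of up-steps, so the window contains at most `⌈a⌉ - 1 ≤ a`
  -- of them, each of probability at most `1/√(2m+1)`.
  have hcard : (s.card : ℝ) ≤ a := by
    have hinj : s.card ≤ (Finset.Ioo (0 : ℤ) ⌈a⌉).card := by
      refine Finset.card_le_card_of_injOn g ?_ ?_
      · intro j hj
        have hj := (Finset.mem_filter.1 hj).2
        exact Finset.mem_coe.2 (Finset.mem_Ioo.2 ⟨hj.1, Int.lt_ceil.2 hj.2⟩)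
      · intro i hi j hj hij
        have hi := Finset.mem_range.1 (Finset.mem_filter.1 hi).1
        have hj := Finset.mem_range.1 (Finset.mem_filter.1 hj).1
        simp only [hg] at hij
        omega
    rw [Int.card_Ioo] at hinj
    have h1 : (0 : ℤ) < ⌈a⌉ := Int.ceil_pos.2 ha
    have h2 : (s.card : ℤ) ≤ ⌈a⌉ - 1 := by omega
    have h3 : (s.card : ℝ) ≤ ⌈a⌉ - 1 := by exact_mod_cast h2
    linarith [Int.ceil_lt_add_one a]
  calc _ ≤ ∑ j ∈ Finset.range (2 * m + 1),
        1 / √(2 * m + 1) * (if 0 < g j ∧ (g j : ℝ) < a then 1 else 0) := by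
        refine Finset.sum_le_sum fun j _ => ?_
        have : ({x : ℤ | 0 < x ∧ (x : ℝ) < a}.indicator 1 (g j) : ℝ) =
          if 0 < g j ∧ (g j : ℝ) < a then 1 else 0 := by
          simp [Set.indicator_apply]
        rw [this]
        exact mul_le_mul_of_nonneg_right (choose_div_le m j) (by split_ifs <;> norm_num)
    _ = 1 / √(2 * m + 1) * s.card := by
        rw [← Finset.mul_sum, Finset.sum_boole]
    _ ≤ 1 / √(2 * m + 1) * a := by gcongr
    _ = _ := by ring

/-- The half line. -/
def posHalf : Set ℤ := {z | 0 < z}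

/-- The `n` steps are cut into a final block of `2 * (n / 4)`, even so that central binomials apply,
and the rest; both have length of order `n`. -/
theorem quarter_bounds (n : ℕ) :
    ((n : ℝ) + 1) / 4 ≤ 2 * (n / 4 : ℕ) + 1 ∧ ((n : ℝ) + 1) / 2 ≤ (n - 2 * (n / 4) : ℕ) + 1 := by
  have h1 : n + 1 ≤ 4 * (2 * (n / 4) + 1) := by omega
  have h2 : n + 1 ≤ 2 * ((n - 2 * (n / 4)) + 1) := by omega
  have h1' : (n : ℝ) + 1 ≤ 4 * (2 * (n / 4 : ℕ) + 1) := by exact_mod_cast h1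
  have h2' : (n : ℝ) + 1 ≤ 2 * ((n - 2 * (n / 4) : ℕ) + 1) := by exact_mod_cast h2
  constructor <;> linarith

theorem srw_univ_pow_quarter_le (n : ℕ) {ε : ℝ} (hε : 0 < ε) (z : ℤ) :
    (srw Set.univ ^ (2 * (n / 4)))
      ({x : ℤ | 0 < x ∧ (x : ℝ) < ε * √(n + 1)}.indicator 1) z ≤ 2 * ε := by
  refine (srw_univ_pow_indicator_le _ (by positivity) z).trans ?_
  rw [div_le_iff₀ (by positivity)]
  have h : √((n : ℝ) + 1) ≤ 2 * √(2 * (n / 4 : ℕ) + 1) := by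
    rw [Real.sqrt_le_left (by positivity), mul_pow, Real.sq_sqrt (by positivity)]
    linarith [(quarter_bounds n).1]
  nlinarith

theorem srw_pow_id_le (n : ℕ) {z : ℤ} (hz : z ∈ posHalf) :
    (srw posHalf ^ n) (fun z => (z : ℝ)) z ≤ z := by
  refine killed_pow_le_of_superharmonic half_nonneg (fun _ _ => le_rfl) (fun z hz => ?_) n hz
  have h1 : ∀ y : ℤ, 0 ≤ y → posHalf.indicator (fun z => (z : ℝ)) y ≤ y := fun y hy =>
    Set.indicator_apply_le' (fun _ => le_rfl) fun _ => by exact_mod_cast hy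
  have hz : 0 < z := hz
  have h2 := h1 (z + 1) (by omega)
  have h3 := h1 (z - 1) (by omega)
  rw [srw_apply]
  push_cast at h2 h3
  linarith

/-- The simple random walk started from `z` stays positive for `n` steps with probability
`O(z / √n)`. -/
theorem srw_survive_le (n : ℕ) {z : ℤ} (hz : z ∈ posHalf) :
    (srw posHalf ^ n) 1 z ≤ 16 * z / √(n + 1) := by
  induction n using Nat.strong_induction_on with
  | _ n ih =>
  have hz1 : (1 : ℝ) ≤ z := by exact_mod_cast (show (1 : ℤ) ≤ z from hz)
  rcases lt_or_ge n 4 with hn | hn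
  · refine (killed_pow_one_le half_nonneg sum_half n z).trans ?_
    rw [le_div_iff₀ (by positivity), one_mul, Real.sqrt_le_left (by positivity)]
    have : (n : ℝ) ≤ 4 := by exact_mod_cast hn.le
    nlinarith
  · have hs : 0 < √((n : ℝ) + 1) := by positivity
    -- With `a = √(n+1)/8`, `1 ≤ z/a + 1_{z<a}`. The first term gives half of the claimed bound. The
    -- second gives `1/4` of the bound for the shorter time, which is larger by a factor of at most
    -- `√2`.
    have key := killed_pow_one_le_of_split (D := posHalf) (p := fun _ => 1 / 2) (step := srwStep)
      half_nonneg
      (show 2 * (n / 4) ≤ n by omega) hz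
      (φ := (1 / (1 / 8 * √(n + 1)) : ℝ) • fun z : ℤ => (z : ℝ))
      (χ := {x : ℤ | 0 < x ∧ (x : ℝ) < 1 / 8 * √(n + 1)}.indicator 1)
      (B := 1 / (1 / 8 * √(n + 1)) * z) (δ := 1 / 4)
      (fun y hy => ?_) ?_ (fun y => ?_)
    · refine key.trans ?_
      have h1 := ih (n - 2 * (n / 4)) (by omega)
      have h2 : 16 * (z : ℝ) / √((n - 2 * (n / 4) : ℕ) + 1) ≤ 16 * z / √((n + 1) / 2) := by
        gcongr
        exact (quarter_bounds n).2
      have h3 : 16 * (z : ℝ) / √((n + 1) / 2) = √2 * (16 * z / √(n + 1)) := by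
        rw [Real.sqrt_div (by positivity)]
        field_simp
      have h4 : √2 ≤ 2 := by
        rw [Real.sqrt_le_left (by norm_num)]; norm_num
      have h5 : 0 ≤ 16 * (z : ℝ) / √(n + 1) := by positivity
      have h6 : 1 / (1 / 8 * √((n : ℝ) + 1)) * z = 1 / 2 * (16 * z / √(n + 1)) := by
        field_simp; norm_num
      rw [h6]
      nlinarith
    · have hy0 : 0 < y := hy
      have hy1 : (0 : ℝ) < y := by exact_mod_cast hy0
      simp only [Pi.smul_apply, smul_eq_mul, Set.indicator_apply, Set.mem_ofPred_eq, Pi.one_apply]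
      split_ifs with h
      · have : 0 ≤ 1 / (1 / 8 * √((n : ℝ) + 1)) * y := by positivity
        linarith
      · have : 1 / 8 * √((n : ℝ) + 1) ≤ y := not_lt.1 fun h' => h ⟨hy0, h'⟩
        rw [add_zero, one_div_mul_eq_div, le_div_iff₀ (by positivity)]
        linarith
    · rw [map_smul, Pi.smul_apply, smul_eq_mul]
      gcongr
      exact srw_pow_id_le n hz
    · refine (killed_pow_mono_set half_nonneg (Set.subset_univ _) (fun x => ?_) _ y).trans
        ((srw_univ_pow_quarter_le n (by norm_num) y).trans (by norm_num))
      exact Set.indicator_nonneg (fun _ _ => zero_le_one) x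

/-- Each step adds at most the survival probability to the second moment, and `1/√(j+1) ≤ 2(√(j+1) -
√j)` telescopes. -/
theorem srw_pow_sq_le (n : ℕ) {z : ℤ} (hz : z ∈ posHalf) :
    (srw posHalf ^ n) (fun z => (z : ℝ) ^ 2) z ≤ z ^ 2 + 32 * z * √n := by
  have hz0 : (0 : ℝ) < z := by exact_mod_cast (show (0 : ℤ) < z from hz)
  induction n with
  | zero => simp
  | succ n ih =>
    have h1 : (srw posHalf ^ (n + 1)) (fun z => (z : ℝ) ^ 2) z ≤
        (srw posHalf ^ n) ((fun z : ℤ => (z : ℝ) ^ 2) + 1) z := by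
      rw [killed_pow_succ_apply']
      refine killed_pow_mono half_nonneg (fun y => ?_) n z
      have h1 : ∀ y : ℤ, posHalf.indicator (fun z => (z : ℝ) ^ 2) y ≤ (y : ℝ) ^ 2 := fun y =>
        Set.indicator_apply_le' (fun _ => le_rfl) fun _ => by positivity
      have h2 := h1 (y + 1)
      have h3 := h1 (y - 1)
      rw [srw_apply]
      push_cast at h2 h3
      simp only [Pi.add_apply, Pi.one_apply]
      linarith
    rw [map_add, Pi.add_apply] at h1
    have h2 := srw_survive_le n hz
    have h3 : 16 * (z : ℝ) / √(n + 1) ≤ 32 * z * (√(n + 1) - √n) := by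
      rw [div_le_iff₀ (by positivity)]
      have ha := Real.sq_sqrt (show (0 : ℝ) ≤ n by positivity)
      have hb := Real.sq_sqrt (show (0 : ℝ) ≤ n + 1 by positivity)
      nlinarith [sq_nonneg (√((n : ℝ) + 1) - √n)]
    push_cast
    linarith

end SimpleWalk

/-! ### Two correlated walks in the quadrant. -/

section PairWalk

/-- The weights of the step `y` of the first walk and of the factor `d` by which the ratio of the
steps of the two walks changes. -/
noncomputable def pairWeight (q : ℝ) (e : ℤˣ × ℤˣ) : ℝ := if e.2 = 1 then (1 - q) / 2 else q / 2

/-- The step of a pair of walks; the last coordinate is the ratio of their last steps. -/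
def pairStep (x : ℤ × ℤ × ℤˣ) (e : ℤˣ × ℤˣ) : ℤ × ℤ × ℤˣ :=
  (x.1 + e.1, x.2.1 + (x.2.2 * e.2 * e.1 : ℤˣ), x.2.2 * e.2)

/-- A pair of simple random walks moving in parallel or antiparallel, with probability `q` of
switching between the two modes, killed outside `D`. -/
noncomputable abbrev pairWalk (q : ℝ) (D : Set (ℤ × ℤ × ℤˣ)) : Module.End ℝ (ℤ × ℤ × ℤˣ → ℝ) :=
  killed (pairWeight q) pairStep D

/-- The states in which both walks are positive. -/
def quadrant : Set (ℤ × ℤ × ℤˣ) := {x | 0 < x.1 ∧ 0 < x.2.1}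

variable {q : ℝ}

theorem pairWeight_nonneg (h0 : 0 < q) (h1 : q ≤ 1 / 2) (e : ℤˣ × ℤˣ) : 0 ≤ pairWeight q e := by
  unfold pairWeight; split_ifs <;> linarith

theorem sum_pairWeight_mul (f : ℤˣ × ℤˣ → ℝ) : ∑ e, pairWeight q e * f e =
    (1 - q) / 2 * (f (1, 1) + f (-1, 1)) + q / 2 * (f (1, -1) + f (-1, -1)) := by
  have h : (-1 : ℤˣ) ≠ 1 := by decide
  rw [Fintype.sum_prod_type, sum_intUnits, sum_intUnits, sum_intUnits]
  simp only [pairWeight, h, if_true, if_false]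
  ring

theorem sum_pairWeight : ∑ e, pairWeight q e = 1 := by
  have := sum_pairWeight_mul (q := q) (fun _ => 1)
  simp only [mul_one] at this
  rw [this]; ring

theorem pairWalk_apply (D : Set (ℤ × ℤ × ℤˣ)) (φ : ℤ × ℤ × ℤˣ → ℝ) (z w : ℤ) (r : ℤˣ) :
    pairWalk q D φ (z, w, r) =
      (1 - q) / 2 * (D.indicator φ (z + 1, w + r, r) + D.indicator φ (z - 1, w - r, r)) +
      q / 2 * (D.indicator φ (z + 1, w - r, -r) + D.indicator φ (z - 1, w + r, -r)) := by
  rw [killed_apply, sum_pairWeight_mul]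
  simp [pairStep, ← sub_eq_add_neg]

theorem pairWalk_univ_pow_fst (φ : ℤ → ℝ) (n : ℕ) (x : ℤ × ℤ × ℤˣ) :
    (pairWalk q Set.univ ^ n) (φ ∘ Prod.fst) x = (srw Set.univ ^ n) φ x.1 := by
  refine killed_pow_comp Set.preimage_univ.symm (fun φ x => ?_) φ n x
  rw [sum_pairWeight_mul, sum_intUnits]
  simp only [pairStep, srwStep]
  ring

theorem pairWalk_univ_pow_snd (φ : ℤ → ℝ) (n : ℕ) (x : ℤ × ℤ × ℤˣ) :
    (pairWalk q Set.univ ^ n) (φ ∘ fun x => x.2.1) x = (srw Set.univ ^ n) φ x.2.1 := by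
  refine killed_pow_comp (π := fun x : ℤ × ℤ × ℤˣ => x.2.1) Set.preimage_univ.symm
    (fun φ x => ?_) φ n x
  obtain ⟨z, w, r⟩ := x
  rw [sum_pairWeight_mul, sum_intUnits]
  rcases Int.units_eq_one_or r with rfl | rfl <;> simp [pairStep, srwStep] <;> ring

/-- A superharmonic majorant of the product of the positions of the two walks. -/
noncomputable def majorant (b μ : ℝ) (x : ℤ × ℤ × ℤˣ) : ℝ :=
  x.1 * x.2.1 + if x.2.2 = 1 then b * (1 - if x.1 = x.2.1 then μ ^ x.1 else 0) else 0

theorem mul_le_majorant {b μ : ℝ} (hb : 0 ≤ b) (hμ0 : 0 < μ) (hμ1 : μ ≤ 1) {x : ℤ × ℤ × ℤˣ}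
    (hx : 0 ≤ x.1) : (x.1 * x.2.1 : ℝ) ≤ majorant b μ x := by
  have h : μ ^ x.1 ≤ 1 := zpow_le_one₀ hμ0 hμ1 hx
  unfold majorant
  split_ifs
  · nlinarith
  · linarith
  · linarith

/-- Without killing, `zw` has drift `1 - 2q` in parallel mode and `-(1 - 2q)` in antiparallel mode;
adding `b = (1 - 2q)/q` in parallel mode compensates both exactly. This alone would start at order
`1/q`. The correction `-b μ^z` on the diagonal records that coinciding walks usually die before
their first switch; hypothesis `hμ` makes it superharmonic there. Parallel moves preserve being on
or off the diagonal, and on entering parallel mode from antiparallel the correction is simply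
dropped. Killing only helps, as the majorant is nonnegative on the closed quadrant. -/
theorem pairWalk_majorant_le {μ : ℝ} (h0 : 0 < q) (h1 : q ≤ 1 / 2) (hμ0 : 0 < μ) (hμ1 : μ ≤ 1)
    (hμ : 2 ≤ (1 - q) * (μ + μ⁻¹)) {x : ℤ × ℤ × ℤˣ} (hx : x ∈ quadrant) :
    pairWalk q quadrant (majorant ((1 - 2 * q) / q) μ) x ≤ majorant ((1 - 2 * q) / q) μ x := by
  obtain ⟨z, w, r⟩ := x
  obtain ⟨hz, hw⟩ : 0 < z ∧ 0 < w := hx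
  set b := (1 - 2 * q) / q with hb
  have hb0 : 0 ≤ b := div_nonneg (by linarith) h0.le
  have hqb : q * b = 1 - 2 * q := by rw [hb]; field_simp
  have hI : ∀ x : ℤ × ℤ × ℤˣ, 0 ≤ x.1 → 0 ≤ x.2.1 →
      quadrant.indicator (majorant b μ) x ≤ majorant b μ x := by
    intro x hx1 hx2
    refine Set.indicator_apply_le' (fun _ => le_rfl) fun _ => ?_
    refine le_trans ?_ (mul_le_majorant hb0 hμ0 hμ1 hx1)
    have h1 : (0 : ℝ) ≤ x.1 := by exact_mod_cast hx1
    have h2 : (0 : ℝ) ≤ x.2.1 := by exact_mod_cast hx2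
    positivity
  have hle : ∀ x : ℤ × ℤ × ℤˣ, 0 ≤ x.1 → majorant b μ x ≤ x.1 * x.2.1 + b := by
    intro x hx1
    have h : 0 ≤ μ ^ x.1 := by positivity
    unfold majorant
    split_ifs
    · nlinarith
    · linarith
    · linarith
  have hneg : (-1 : ℤˣ) ≠ 1 := by decide
  have hq1 : 0 ≤ (1 - q) / 2 := by linarith
  have hq2 : 0 ≤ q / 2 := by linarith
  rw [pairWalk_apply]
  rcases Int.units_eq_one_or r with rfl | rfl
  · have e3 := hI (z + 1, w - 1, -1) (by simp; omega) (by simp; omega)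
    have e4 := hI (z - 1, w + 1, -1) (by simp; omega) (by simp; omega)
    have e1 := hI (z + 1, w + 1, 1) (by simp; omega) (by simp; omega)
    have e2 := hI (z - 1, w - 1, 1) (by simp; omega) (by simp; omega)
    simp only [Units.val_one]
    refine (add_le_add (mul_le_mul_of_nonneg_left (add_le_add e1 e2) hq1)
      (mul_le_mul_of_nonneg_left (add_le_add e3 e4) hq2)).trans ?_
    by_cases hzw : z = w
    · subst hzw
      have hp : μ ^ (z + 1) = μ ^ z * μ := by rw [zpow_add₀ hμ0.ne', zpow_one]
      have hm : μ ^ (z - 1) = μ ^ z * μ⁻¹ := by rw [zpow_sub₀ hμ0.ne', zpow_one]; rfl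
      have hpos : 0 < μ ^ z := by positivity
      have hprod : 0 ≤ b * μ ^ z * ((1 - q) * (μ + μ⁻¹) - 2) :=
        mul_nonneg (by positivity) (by linarith)
      simp only [majorant, hneg, if_true, if_false, hp, hm]
      push_cast
      nlinarith
    · simp only [majorant, hneg, if_true, if_false, hzw, add_left_inj, sub_left_inj]
      push_cast
      nlinarith
  · have e1 := hI (z + 1, w - 1, -1) (by simp; omega) (by simp; omega)
    have e2 := hI (z - 1, w + 1, -1) (by simp; omega) (by simp; omega)
    have e3 := (hI (z + 1, w + 1, 1) (by simp; omega) (by simp; omega)).trans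
      (hle (z + 1, w + 1, 1) (by simp; omega))
    have e4 := (hI (z - 1, w - 1, 1) (by simp; omega) (by simp; omega)).trans
      (hle (z - 1, w - 1, 1) (by simp; omega))
    simp only [Units.val_one, Units.val_neg, ← sub_eq_add_neg, sub_neg_eq_add, neg_neg]
    refine (add_le_add (mul_le_mul_of_nonneg_left (add_le_add e1 e2) hq1)
      (mul_le_mul_of_nonneg_left (add_le_add e3 e4) hq2)).trans ?_
    simp only [majorant, hneg, if_false]
    push_cast
    nlinarith

/-- The expected product of the positions on survival. -/
theorem pairWalk_pow_mul_le (h0 : 0 < q) (h1 : q ≤ 1 / 2) (n : ℕ) :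
    (pairWalk q quadrant ^ n) (fun x => (x.1 * x.2.1 : ℝ)) (1, 1, 1) ≤ 1 + 4 / √q := by
  have hs : 0 < √q := Real.sqrt_pos.2 h0
  have hsq : √q ^ 2 = q := Real.sq_sqrt h0.le
  -- `1 - μ` must be `O(√q)` to reduce `b ≤ 1/q` to `O(1/√q)`, while `μ + μ⁻¹ - 2` must absorb the
  -- loss of the factor `1 - q`; here it is at least `4q`.
  set μ : ℝ := (1 + 4 * √q)⁻¹ with hμdef
  have hμ0 : 0 < μ := by positivity
  have hμ1 : μ ≤ 1 := inv_le_one_of_one_le₀ (by linarith)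
  have hμ : 2 ≤ (1 - q) * (μ + μ⁻¹) := by
    have hs2 : √q ≤ 3 / 4 := by
      rw [Real.sqrt_le_left (by norm_num)]; linarith
    have : μ + μ⁻¹ = 2 + 16 * q / (1 + 4 * √q) := by
      rw [hμdef, inv_inv]
      field_simp
      nlinarith
    rw [this]
    have h2 : 16 * q / (1 + 4 * √q) ≥ 4 * q := by
      rw [ge_iff_le, le_div_iff₀ (by positivity)]
      nlinarith
    nlinarith
  have hb0 : 0 ≤ (1 - 2 * q) / q := div_nonneg (by linarith) h0.le
  refine (killed_pow_le_of_superharmonic (pairWeight_nonneg h0 h1)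
    (fun x hx => mul_le_majorant hb0 hμ0 hμ1 hx.1.le)
    (fun x hx => pairWalk_majorant_le h0 h1 hμ0 hμ1 hμ hx) n
    (show ((1, 1, 1) : ℤ × ℤ × ℤˣ) ∈ quadrant from ⟨one_pos, one_pos⟩)).trans ?_
  simp only [majorant, if_true, zpow_one, Int.cast_one, one_mul]
  gcongr
  have h2 : 1 - μ ≤ 4 * √q := by
    rw [hμdef, sub_le_iff_le_add, ← sub_le_iff_le_add', inv_eq_one_div, le_div_iff₀ (by positivity)]
    nlinarith
  calc (1 - 2 * q) / q * (1 - μ) ≤ 1 / q * (4 * √q) := by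
        gcongr
        · linarith
    _ = 4 / √q := by
        rw [← hsq]; field_simp; rw [Real.sqrt_sq hs.le]

theorem pairWalk_survive_le (h0 : 0 < q) (h1 : q ≤ 1 / 2) (n : ℕ) :
    (pairWalk q quadrant ^ n) 1 (1, 1, 1) ≤ 1024 * (1 + 4 / √q) / (n + 1) := by
  have hp := pairWeight_nonneg h0 h1
  have hM : 1 ≤ 1 + 4 / √q := by
    have : 0 ≤ 4 / √q := by positivity
    linarith
  set M := 1 + 4 / √q with hMdef
  induction n using Nat.strong_induction_on with
  | _ n ih =>
  rcases lt_or_ge n 4 with hn | hn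
  · refine (killed_pow_one_le hp sum_pairWeight n _).trans ?_
    rw [le_div_iff₀ (by positivity)]
    have : (n : ℝ) ≤ 4 := by exact_mod_cast hn.le
    linarith
  · set a := 1 / 16 * √((n : ℝ) + 1) with ha
    have ha0 : 0 < a := by positivity
    have ha2 : a ^ 2 = (n + 1) / 256 := by
      rw [ha, mul_pow, Real.sq_sqrt (by positivity)]; ring
    set χ : ℤ → ℝ := {x : ℤ | 0 < x ∧ (x : ℝ) < a}.indicator 1 with hχ
    have hχ0 : ∀ x, 0 ≤ χ x := Set.indicator_nonneg fun _ _ => zero_le_one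
    -- Either `zw ≥ a²` or one coordinate is below `a`. The first case contributes `1/4` of the
    -- claimed bound. Each coordinate alone is a simple walk, so the second costs `2 · 1/8` times
    -- the shorter-time bound, which is at most twice the claimed one.
    have key := killed_pow_one_le_of_split (D := quadrant) (p := pairWeight q) (step := pairStep)
      hp (show 2 * (n / 4) ≤ n by omega)
      (show ((1, 1, 1) : ℤ × ℤ × ℤˣ) ∈ quadrant from ⟨one_pos, one_pos⟩)
      (φ := (1 / a ^ 2) • fun x => (x.1 * x.2.1 : ℝ))
      (χ := χ ∘ Prod.fst + χ ∘ fun x => x.2.1)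
      (B := 1 / a ^ 2 * M) (δ := 1 / 4)
      (fun y hy => ?_) ?_ (fun y => ?_)
    · refine key.trans ?_
      have h1 := ih (n - 2 * (n / 4)) (by omega)
      have h2 : 1024 * M / ((n - 2 * (n / 4) : ℕ) + 1) ≤ 1024 * M / ((n + 1) / 2) := by
        gcongr
        exact (quarter_bounds n).2
      have h3 : 1024 * M / ((n + 1) / 2) = 2 * (1024 * M / (n + 1)) := by
        field_simp
      have h5 : 0 ≤ 1024 * M / (n + 1) := by positivity
      have h6 : 1 / a ^ 2 * M = 1 / 4 * (1024 * M / (n + 1)) := by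
        rw [ha2]; field_simp; norm_num
      rw [h6]
      linarith
    · obtain ⟨z, w, r⟩ := y
      obtain ⟨hz, hw⟩ : 0 < z ∧ 0 < w := hy
      have hz1 : (0 : ℝ) < z := by exact_mod_cast hz
      have hw1 : (0 : ℝ) < w := by exact_mod_cast hw
      have hprod : 0 ≤ 1 / a ^ 2 * (z * w : ℝ) := by positivity
      simp only [Pi.smul_apply, smul_eq_mul, Pi.add_apply, Function.comp_apply]
      by_cases hza : (z : ℝ) < a
      · have : χ z = 1 := Set.indicator_of_mem (show z ∈ {x : ℤ | 0 < x ∧ (x : ℝ) < a} from ⟨hz, hza⟩) _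
        linarith [hχ0 w]
      · by_cases hwa : (w : ℝ) < a
        · have : χ w = 1 := Set.indicator_of_mem (show w ∈ {x : ℤ | 0 < x ∧ (x : ℝ) < a} from ⟨hw, hwa⟩) _
          linarith [hχ0 z]
        · have : 1 ≤ 1 / a ^ 2 * (z * w : ℝ) := by
            rw [one_div_mul_eq_div, le_div_iff₀ (by positivity)]
            nlinarith
          linarith [hχ0 z, hχ0 w]
    · rw [map_smul, Pi.smul_apply, smul_eq_mul]
      gcongr
      exact pairWalk_pow_mul_le h0 h1 n
    · rw [map_add, Pi.add_apply]
      have e1 := (killed_pow_mono_set (step := pairStep) (φ := χ ∘ Prod.fst) hp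
        (Set.subset_univ quadrant) (fun x => hχ0 _) (2 * (n / 4)) y).trans
        ((pairWalk_univ_pow_fst χ _ y).trans_le
        (srw_univ_pow_quarter_le n (by norm_num) _))
      have e2 := (killed_pow_mono_set (step := pairStep) (φ := χ ∘ fun x => x.2.1) hp
        (Set.subset_univ quadrant) (fun x => hχ0 _) (2 * (n / 4)) y).trans
        ((pairWalk_univ_pow_snd χ _ y).trans_le
        (srw_univ_pow_quarter_le n (by norm_num) _))
      linarith

theorem pairWalk_survive_zero_le (h0 : 0 < q) (h1 : q ≤ 1 / 2) (n : ℕ) :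
    (pairWalk q quadrant ^ n) 1 (0, 0, 1) ≤ 10240 / (√q * (n + 1)) := by
  have hs : 0 < √q := Real.sqrt_pos.2 h0
  have hs1 : √q ≤ 1 := Real.sqrt_le_one.2 (by linarith)
  rw [le_div_iff₀ (by positivity)]
  cases n with
  | zero => simp; linarith
  | succ n =>
    have hstep : (pairWalk q quadrant ^ (n + 1)) 1 (0, 0, 1) ≤
        (pairWalk q quadrant ^ n) 1 (1, 1, 1) := by
      rw [killed_pow_succ_apply]
      have hnn := killed_pow_nonneg (step := pairStep) (D := quadrant) (pairWeight_nonneg h0 h1)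
        (fun _ => zero_le_one) n (1, 1, 1) (φ := 1)
      refine (pairWalk_apply _ _ _ _ _).trans_le ?_
      rw [Set.indicator_of_mem (by simp [quadrant]), Set.indicator_of_notMem (by simp [quadrant]),
        Set.indicator_of_notMem (by simp [quadrant]), Set.indicator_of_notMem (by simp [quadrant])]
      simp only [zero_add, Units.val_one]
      nlinarith
    have h2 := hstep.trans (pairWalk_survive_le h0 h1 n)
    have h3 : 1024 * (1 + 4 / √q) / (n + 1) * (√q * ((n : ℝ) + 2)) ≤ 10240 := by
      have e : 1024 * (1 + 4 / √q) / (n + 1) * (√q * ((n : ℝ) + 2)) =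
          1024 * (√q + 4) * ((n + 2) / (n + 1)) := by
        field_simp
      have e2 : ((n : ℝ) + 2) / (n + 1) ≤ 2 := by
        rw [div_le_iff₀ (by positivity)]; linarith [(Nat.cast_nonneg n : (0 : ℝ) ≤ n)]
      rw [e]
      calc _ ≤ 1024 * (1 + 4) * (2 : ℝ) := by gcongr
        _ = _ := by norm_num
    push_cast
    refine le_trans ?_ h3
    have : (n : ℝ) + 1 + 1 = n + 2 := by ring
    rw [this]
    gcongr

end PairWalk

/-! ### Reduction of two switch walks to the pair walk. -/

section BitWalk

/-- The joint law of a bit at two times. -/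
noncomputable def bitWeight (q : ℝ) (e : ℤˣ × ℤˣ) : ℝ := if e.1 = e.2 then (1 - q) / 2 else q / 2

/-- The step of a pair of switch walks; the last two coordinates are their last steps. -/
def bitStep (x : ℤ × ℤ × ℤˣ × ℤˣ) (e : ℤˣ × ℤˣ) : ℤ × ℤ × ℤˣ × ℤˣ :=
  (x.1 + (x.2.2.1 * e.1 : ℤˣ), x.2.1 + (x.2.2.2 * e.2 : ℤˣ), x.2.2.1 * e.1, x.2.2.2 * e.2)

/-- The law of the next positions and of the next ratio of steps depends on the two last steps only
through their ratio, so the chain projects onto `pairWalk`. -/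
theorem bitWalk_survive_le {q : ℝ} (h0 : 0 < q) (h1 : q ≤ 1 / 2) (n : ℕ) :
    (killed (bitWeight q) bitStep {x | 0 < x.1 ∧ 0 < x.2.1} ^ n) 1 (0, 0, 1, 1) ≤
      10240 / (√q * (n + 1)) := by
  refine le_trans (le_of_eq ?_) (pairWalk_survive_zero_le h0 h1 n)
  refine killed_pow_comp (S' := ℤ × ℤ × ℤˣ) (E' := ℤˣ × ℤˣ)
    (π := fun x : ℤ × ℤ × ℤˣ × ℤˣ => (x.1, x.2.1, x.2.2.1 * x.2.2.2)) (D' := quadrant)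
    (p' := pairWeight q) (step' := pairStep) rfl (fun φ x => ?_) 1 n (0, 0, 1, 1)
  obtain ⟨z, w, y, v⟩ := x
  have hneg : (-1 : ℤˣ) ≠ 1 := by decide
  have hneg' : (1 : ℤˣ) ≠ -1 := by decide
  rw [sum_pairWeight_mul, Fintype.sum_prod_type, sum_intUnits, sum_intUnits, sum_intUnits]
  rcases Int.units_eq_one_or y with rfl | rfl <;> rcases Int.units_eq_one_or v with rfl | rfl <;>
    simp [bitStep, pairStep, bitWeight, hneg, hneg'] <;> ring

end BitWalk

/-! ### Lower bound for survival above the curve `i ^ α`. -/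

section CurvedBoundary

/-- The step of the simple random walk together with its time. -/
def timedStep (x : ℕ × ℤ) (y : ℤˣ) : ℕ × ℤ := (x.1 + 1, x.2 + y)

/-- The positive states above the curve `i ^ α`. -/
def aboveCurve (α : ℝ) : Set (ℕ × ℤ) := {x | 0 < x.2 ∧ (x.1 : ℝ) ^ α ≤ x.2}

/-- The simple random walk with its time, killed below the curve `i ^ α`. -/
noncomputable abbrev timedWalk (α : ℝ) : Module.End ℝ (ℕ × ℤ → ℝ) :=
  killed (fun _ : ℤˣ => (1 / 2 : ℝ)) timedStep (aboveCurve α)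

variable {α : ℝ}

theorem timedWalk_apply (φ : ℕ × ℤ → ℝ) (x : ℕ × ℤ) :
    timedWalk α φ x = ((aboveCurve α).indicator φ (x.1 + 1, x.2 + 1) +
      (aboveCurve α).indicator φ (x.1 + 1, x.2 - 1)) / 2 := by
  rw [killed_apply, sum_intUnits]
  simp only [timedStep, Units.val_one, Units.val_neg, ← sub_eq_add_neg]
  ring

theorem timedWalk_pow_le {ψ : ℤ → ℝ} (hψ : ∀ z, 0 ≤ ψ z) (n : ℕ) (x : ℕ × ℤ) :
    (timedWalk α ^ n) (ψ ∘ Prod.snd) x ≤ (srw posHalf ^ n) ψ x.2 := by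
  refine (killed_pow_mono_set (D' := Prod.snd ⁻¹' posHalf) half_nonneg (fun x hx => hx.1)
    (fun x => hψ _) n x).trans (le_of_eq ?_)
  exact killed_pow_comp rfl (fun φ x => rfl) ψ n x

theorem timedWalk_pow_fst (g : ℕ → ℝ) (n : ℕ) (x : ℕ × ℤ) :
    (timedWalk α ^ n) (g ∘ Prod.fst) x = g (x.1 + n) * (timedWalk α ^ n) 1 x := by
  induction n generalizing x with
  | zero => simp
  | succ n ih =>
    rw [killed_pow_succ_apply, killed_pow_succ_apply]
    simp only [killed_apply, Finset.mul_sum]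
    refine Finset.sum_congr rfl fun y _ => ?_
    by_cases h : timedStep x y ∈ aboveCurve α
    · rw [Set.indicator_of_mem h, Set.indicator_of_mem h, ih]
      have : (timedStep x y).1 + n = x.1 + (n + 1) := by simp only [timedStep]; ring
      rw [this]; ring
    · simp [h]

theorem rpow_succ_sub_le (h1 : α ≤ 1) (i : ℕ) :
    ((i : ℝ) + 1) ^ α ≤ (i : ℝ) ^ α + ((i : ℝ) + 1) ^ (α - 1) := by
  have hi : (0 : ℝ) < i + 1 := by positivity
  have hr : (i : ℝ) / (i + 1) ≤ 1 := by rw [div_le_one hi]; linarith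
  have h2 : ((i : ℝ) / (i + 1)) ≤ ((i : ℝ) / (i + 1)) ^ α := by
    rcases Nat.eq_zero_or_pos i with rfl | hpos
    · simpa using Real.rpow_nonneg le_rfl α
    · have hpos' : (0 : ℝ) < i := by exact_mod_cast hpos
      simpa using Real.rpow_le_rpow_of_exponent_ge (by positivity) hr h1
  rw [Real.div_rpow (by positivity) hi.le, div_le_div_iff₀ hi (by positivity)] at h2
  rw [Real.rpow_sub_one hi.ne', ← sub_le_iff_le_add', le_div_iff₀ hi]
  linarith

/-- Killing happens where `z - i^α ≤ 0`, so it can only raise the mean of `z - i^α`. The sole loss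
per step is the increment of the curve times the probability of being alive. -/
theorem le_timedWalk_pow (h1 : α ≤ 1) (n : ℕ) (x : ℕ × ℤ) :
    x.2 - (x.1 : ℝ) ^ α -
        ∑ j ∈ Finset.range n, (((x.1 + j : ℕ) : ℝ) + 1) ^ (α - 1) * (timedWalk α ^ j) 1 x ≤
      (timedWalk α ^ n) (fun x => x.2 - (x.1 : ℝ) ^ α) x := by
  induction n with
  | zero => simp
  | succ n ih =>
    let φ : ℕ × ℤ → ℝ := fun x => x.2 - (x.1 : ℝ) ^ α
    let Δ : ℕ × ℤ → ℝ := (fun i : ℕ => ((i : ℝ) + 1) ^ (α - 1)) ∘ Prod.fst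
    have hstep : ∀ x : ℕ × ℤ, (φ - Δ) x ≤ timedWalk α φ x := by
      intro x
      have hI : ∀ y : ℕ × ℤ, (y.2 : ℝ) - (y.1 : ℝ) ^ α ≤
          (aboveCurve α).indicator φ y := by
        intro y
        refine Set.le_indicator_apply (fun _ => le_rfl) fun hy => ?_
        by_cases hy0 : 0 < y.2
        · have : ¬ (y.1 : ℝ) ^ α ≤ y.2 := fun h => hy ⟨hy0, h⟩
          linarith
        · have h2 : (y.2 : ℝ) ≤ 0 := by exact_mod_cast not_lt.1 hy0
          have h3 : 0 ≤ (y.1 : ℝ) ^ α := by positivity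
          linarith
      have e1 := hI (x.1 + 1, x.2 + 1)
      have e2 := hI (x.1 + 1, x.2 - 1)
      have e3 := rpow_succ_sub_le h1 x.1
      rw [timedWalk_apply]
      simp only [Pi.sub_apply, Function.comp_apply, φ, Δ] at e1 e2 ⊢
      push_cast at e1 e2
      linarith
    have h2 := killed_pow_mono (D := aboveCurve α) (step := timedStep) half_nonneg hstep n x
    rw [map_sub, Pi.sub_apply, show (timedWalk α ^ n) Δ x = _ from timedWalk_pow_fst _ n x] at h2
    rw [killed_pow_succ_apply', Finset.sum_range_succ]
    simp only [φ] at h2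
    linarith

/-- Interpolation: `x ≤ 1` and `x ≤ y` give `x ≤ x^β ≤ y^β`. This trades decay in `j` for a power of
`m` below `1`. -/
theorem timedWalk_pow_one_le_rpow {β : ℝ} (hβ0 : 0 ≤ β) (hβ1 : β ≤ 1) {m : ℕ} (hm : 0 < m) (j : ℕ) :
    (timedWalk α ^ j) 1 (m, m) ≤ (16 * m) ^ β * ((j : ℝ) + 1) ^ (-(β / 2)) := by
  have hm' : (0 : ℝ) < m := by exact_mod_cast hm
  have h0 : 0 ≤ (timedWalk α ^ j) 1 (m, m) :=
    killed_pow_nonneg half_nonneg (fun _ => zero_le_one) j _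
  have h1 : (timedWalk α ^ j) 1 (m, m) ≤ 1 := killed_pow_one_le half_nonneg sum_half j _
  have h2 : (timedWalk α ^ j) 1 (m, m) ≤ 16 * m / √(j + 1) := by
    have := (timedWalk_pow_le (α := α) (ψ := 1) (fun _ => zero_le_one) j (m, m)).trans
      (srw_survive_le j (z := m) (show (0 : ℤ) < m by exact_mod_cast hm))
    exact_mod_cast this
  have h3 : (16 * m / √((j : ℝ) + 1)) ^ β = (16 * m) ^ β * ((j : ℝ) + 1) ^ (-(β / 2)) := by
    rw [Real.div_rpow (by positivity) (by positivity), Real.sqrt_eq_rpow,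
      ← Real.rpow_mul (by positivity), Real.rpow_neg (by positivity), div_eq_mul_inv]
    ring_nf
  rw [← h3]
  refine le_trans ?_ (Real.rpow_le_rpow h0 h2 hβ0)
  rcases h0.eq_or_lt with h | h
  · rw [← h]; positivity
  · simpa using Real.rpow_le_rpow_of_exponent_ge h h1 hβ1

theorem exists_le_timedWalk_pow (h0 : 0 ≤ α) (h1 : α < 1 / 2) :
    ∃ m : ℕ, 0 < m ∧ ∀ n, (m : ℝ) / 2 ≤ (timedWalk α ^ n) (fun x => (x.2 : ℝ)) (m, m) := by
  -- Summability of the losses needs `β > 2α`, and a total loss `O(m^β)` that is negligible against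
  -- `m` needs `β < 1`; `α < 1/2` allows both.
  set β := α + 1 / 2 with hβ
  set g : ℕ → ℝ := fun j => ((j : ℝ) + 1) ^ (α - 1 - β / 2) with hg
  have hsum : Summable g := by
    have := (summable_nat_add_iff 1).2 (Real.summable_nat_rpow.2
      (show α - 1 - β / 2 < -1 by rw [hβ]; linarith))
    simpa [hg] using this
  have hg0 : ∀ j, 0 ≤ g j := fun j => by positivity
  have htend : Filter.Tendsto (fun m : ℕ => (m : ℝ) ^ (1 - β)) Filter.atTop Filter.atTop :=
    (tendsto_rpow_atTop (show 0 < 1 - β by rw [hβ]; linarith)).comp tendsto_natCast_atTop_atTop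
  obtain ⟨m, hm, hm0⟩ := ((htend.eventually_ge_atTop
    (2 * (1 + 16 ^ β * ∑' j, g j))).and (Filter.eventually_gt_atTop 0)).exists
  refine ⟨m, hm0, fun n => ?_⟩
  have hm1 : (1 : ℝ) ≤ m := by exact_mod_cast hm0
  have hm' : (0 : ℝ) < m := by linarith
  have hle := le_timedWalk_pow (α := α) (by linarith) n (m, (m : ℤ))
  have hmono : (timedWalk α ^ n) (fun x => x.2 - (x.1 : ℝ) ^ α) (m, m) ≤
      (timedWalk α ^ n) (fun x => (x.2 : ℝ)) (m, m) :=
    killed_pow_mono half_nonneg (fun x => by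
      have : 0 ≤ (x.1 : ℝ) ^ α := by positivity
      linarith) n _
  have hsumle : ∑ j ∈ Finset.range n,
      (((m + j : ℕ) : ℝ) + 1) ^ (α - 1) * (timedWalk α ^ j) 1 (m, (m : ℤ)) ≤
      (16 * m) ^ β * ∑' j, g j := by
    calc _ ≤ ∑ j ∈ Finset.range n, (16 * m) ^ β * g j := by
          refine Finset.sum_le_sum fun j _ => ?_
          have e1 := timedWalk_pow_one_le_rpow (α := α) (β := β) (by rw [hβ]; linarith)
            (by rw [hβ]; linarith) hm0 j
          have e2 : (((m + j : ℕ) : ℝ) + 1) ^ (α - 1) ≤ ((j : ℝ) + 1) ^ (α - 1) := by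
            refine Real.rpow_le_rpow_of_nonpos (by positivity) ?_ (by linarith)
            push_cast; linarith
          calc _ ≤ ((j : ℝ) + 1) ^ (α - 1) * ((16 * m) ^ β * ((j : ℝ) + 1) ^ (-(β / 2))) :=
                mul_le_mul e2 e1 (killed_pow_nonneg half_nonneg (fun _ => zero_le_one) j _)
                  (by positivity)
            _ = (16 * m) ^ β * (((j : ℝ) + 1) ^ (α - 1) * ((j : ℝ) + 1) ^ (-(β / 2))) := by ring
            _ = _ := by rw [← Real.rpow_add (by positivity), ← sub_eq_add_neg]
      _ = (16 * m) ^ β * ∑ j ∈ Finset.range n, g j := by rw [Finset.mul_sum]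
      _ ≤ _ := by
          gcongr
          exact hsum.sum_le_tsum _ fun j _ => hg0 j
  have hpow : (m : ℝ) ^ α ≤ (m : ℝ) ^ β :=
    Real.rpow_le_rpow_of_exponent_le hm1 (by rw [hβ]; linarith)
  have hfin : (m : ℝ) ^ β * (1 + 16 ^ β * ∑' j, g j) ≤ m / 2 := by
    have e1 : (m : ℝ) ^ β * (m : ℝ) ^ (1 - β) = m := by
      rw [← Real.rpow_add hm', add_sub_cancel, Real.rpow_one]
    have e2 : 0 ≤ (m : ℝ) ^ β := by positivity
    nlinarith
  rw [Real.mul_rpow (by norm_num) hm'.le] at hsumle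
  simp only [Int.cast_natCast] at hle hmono ⊢
  nlinarith

/-- Second moment argument via `z ≤ z²/(2L) + L/2`: with `L` of order `m √(n+1)` the quadratic term
takes at most half of the mean `m/2`, so the constant term forces survival. -/
theorem exists_le_timedWalk_survive (h0 : 0 ≤ α) (h1 : α < 1 / 2) :
    ∃ m : ℕ, ∀ n : ℕ, 1 / (132 * √((n : ℝ) + 1)) ≤ (timedWalk α ^ n) 1 (m, m) := by
  obtain ⟨m, hm, h⟩ := exists_le_timedWalk_pow h0 h1
  refine ⟨m, fun n => ?_⟩
  have hm1 : (1 : ℝ) ≤ m := by exact_mod_cast hm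
  have hm' : (0 : ℝ) < m := by linarith
  have hs1 : 1 ≤ √((n : ℝ) + 1) := Real.one_le_sqrt.2 (by linarith [(Nat.cast_nonneg n : (0 : ℝ) ≤ n)])
  have hs : √(n : ℝ) ≤ √((n : ℝ) + 1) := Real.sqrt_le_sqrt (by linarith)
  set s := √((n : ℝ) + 1) with hsdef
  set L : ℝ := 66 * m * s with hL
  have hL0 : 0 < L := by positivity
  have hsq : (timedWalk α ^ n) ((fun z : ℤ => (z : ℝ) ^ 2) ∘ Prod.snd) (m, m) ≤ 33 * m ^ 2 * s := by
    refine (timedWalk_pow_le (fun _ => by positivity) n _).trans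
      ((srw_pow_sq_le n (z := m) (show (0 : ℤ) < m by exact_mod_cast hm)).trans ?_)
    push_cast
    have e1 : (m : ℝ) * √n ≤ m * (m * s) := by gcongr; nlinarith
    nlinarith
  have hlin : (timedWalk α ^ n) (fun x => (x.2 : ℝ)) (m, m) ≤
      1 / (2 * L) * (timedWalk α ^ n) ((fun z : ℤ => (z : ℝ) ^ 2) ∘ Prod.snd) (m, m) +
        L / 2 * (timedWalk α ^ n) 1 (m, m) := by
    have := killed_pow_mono (D := aboveCurve α) (step := timedStep) half_nonneg
      (φ := fun x => (x.2 : ℝ))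
      (ψ := (1 / (2 * L)) • ((fun z : ℤ => (z : ℝ) ^ 2) ∘ Prod.snd) + (L / 2) • 1)
      (fun x => ?_) n (m, m)
    · simpa only [map_add, map_smul, Pi.add_apply, Pi.smul_apply, smul_eq_mul] using this
    · simp only [Pi.add_apply, Pi.smul_apply, smul_eq_mul, Function.comp_apply, Pi.one_apply]
      have e : 1 / (2 * L) * (x.2 : ℝ) ^ 2 + L / 2 * 1 - x.2 = 1 / (2 * L) * (x.2 - L) ^ 2 := by
        field_simp; ring
      have : 0 ≤ 1 / (2 * L) * ((x.2 : ℝ) - L) ^ 2 := by positivity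
      linarith
  have h2 : 1 / (2 * L) * (timedWalk α ^ n) ((fun z : ℤ => (z : ℝ) ^ 2) ∘ Prod.snd) (m, m) ≤
      m / 4 := by
    calc _ ≤ 1 / (2 * L) * (33 * m ^ 2 * s) := by gcongr
      _ = m / 4 := by rw [hL]; field_simp; norm_num
  have h3 := h n
  have h4 : (m : ℝ) / 4 ≤ L / 2 * (timedWalk α ^ n) 1 (m, m) := by linarith
  rw [div_le_iff₀ (by positivity)]
  have h5 : L / 2 * (timedWalk α ^ n) 1 (m, m) = m / 4 * ((timedWalk α ^ n) 1 (m, m) * (132 * s)) := by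
    rw [hL]; ring
  rw [h5] at h4
  nlinarith

/-- The walk reaches `(m, m)` by going straight up, at cost `2^{-m}`; the diagonal stays above the
curve since `α ≤ 1`. -/
theorem timedWalk_diagonal_le (h1 : α ≤ 1) (m n : ℕ) :
    (1 / 2 : ℝ) ^ m * (timedWalk α ^ n) 1 (m, m) ≤ (timedWalk α ^ (m + n)) 1 (0, 0) := by
  induction m generalizing n with
  | zero => simp
  | succ m ih =>
    have hnn := fun x => killed_pow_nonneg (step := timedStep) (D := aboveCurve α) half_nonneg
        (fun _ => zero_le_one) n x (φ := 1)
    have hmem : ((m + 1, (m : ℤ) + 1) : ℕ × ℤ) ∈ aboveCurve α := by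
      refine ⟨by positivity, ?_⟩
      push_cast
      simpa using Real.rpow_le_rpow_of_exponent_le
        (show (1 : ℝ) ≤ m + 1 by linarith [(Nat.cast_nonneg m : (0 : ℝ) ≤ m)]) h1
    have hstep : 1 / 2 * (timedWalk α ^ n) 1 (m + 1, (m : ℤ) + 1) ≤
        (timedWalk α ^ (n + 1)) 1 (m, m) := by
      rw [killed_pow_succ_apply]
      refine le_trans ?_ (timedWalk_apply _ _).ge
      rw [Set.indicator_of_mem hmem]
      have := Set.indicator_nonneg (s := aboveCurve α) (fun x _ => hnn x) (m + 1, (m : ℤ) - 1)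
      linarith
    calc _ = (1 / 2 : ℝ) ^ m * (1 / 2 * (timedWalk α ^ n) 1 (m + 1, (m : ℤ) + 1)) := by
          push_cast; ring
      _ ≤ (1 / 2 : ℝ) ^ m * (timedWalk α ^ (n + 1)) 1 (m, m) := by gcongr
      _ ≤ _ := by
          rw [show m + 1 + n = m + (n + 1) by ring]
          exact ih (n + 1)

/-- The step of a switch walk with its time; the last coordinate is its last step. -/
def signStep (x : ℕ × ℤ × ℤˣ) (e : ℤˣ) : ℕ × ℤ × ℤˣ :=
  (x.1 + 1, x.2.1 + (x.2.2 * e : ℤˣ), x.2.2 * e)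

theorem exists_le_signWalk_survive (h0 : 0 ≤ α) (h1 : α < 1 / 2) :
    ∃ c : ℝ, 0 < c ∧ ∀ n : ℕ, c / √((n : ℝ) + 1) ≤
      (killed (fun _ : ℤˣ => (1 / 2 : ℝ)) signStep
        {x | 0 < x.2.1 ∧ (x.1 : ℝ) ^ α ≤ x.2.1} ^ n) 1 (0, 0, 1) := by
  obtain ⟨m, h⟩ := exists_le_timedWalk_survive h0 h1
  refine ⟨(1 / 2) ^ m * (1 / 132), by positivity, fun n => ?_⟩
  have e1 : (killed (fun _ : ℤˣ => (1 / 2 : ℝ)) signStep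
        {x | 0 < x.2.1 ∧ (x.1 : ℝ) ^ α ≤ x.2.1} ^ n) 1 (0, 0, 1) =
      (timedWalk α ^ n) 1 (0, 0) := by
    refine killed_pow_comp (S' := ℕ × ℤ) (π := fun x : ℕ × ℤ × ℤˣ => (x.1, x.2.1))
      (D' := aboveCurve α) (step' := timedStep) rfl (fun φ x => ?_) 1 n (0, 0, 1)
    obtain ⟨i, z, y⟩ := x
    rw [sum_intUnits, sum_intUnits]
    rcases Int.units_eq_one_or y with rfl | rfl <;> simp [signStep, timedStep, add_comm]
  rw [e1]
  calc _ = (1 / 2 : ℝ) ^ m * (1 / (132 * √((n : ℝ) + 1))) := by field_simp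
    _ ≤ (1 / 2 : ℝ) ^ m * (timedWalk α ^ n) 1 (m, m) := by
        gcongr
        exact h n
    _ ≤ (timedWalk α ^ (m + n)) 1 (0, 0) := timedWalk_diagonal_le (by linarith) m n
    _ ≤ _ := killed_pow_one_antitone half_nonneg sum_half _ (by omega)

end CurvedBoundary

/-! ### Integer-valued signs as units. -/

section Sign

instance : MeasurableSingletonClass ℤˣ :=
  ⟨fun e => ⟨{(e : ℤ)}, measurableSet_singleton _, by ext; simp [Units.ext_iff]⟩⟩

theorem walk_succ (x : ℕ → ℤ) (n : ℕ) :
    walk x (n + 1) = walk x n + ∏ j ∈ Finset.range (n + 1), x j :=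
  Finset.sum_range_succ _ _

/-- The sign of a number in `{1, -1}`. -/
def toSign (x : ℤ) : ℤˣ := if x = 1 then 1 else -1

theorem coe_toSign {x : ℤ} (hx : x = 1 ∨ x = -1) : (toSign x : ℤ) = x := by
  rcases hx with rfl | rfl <;> rfl

theorem orbit_signStep (x : ℕ → ℤ) (hx : ∀ j, x j = 1 ∨ x j = -1) (n : ℕ) :
    orbit signStep (0, 0, 1) (fun j => toSign (x j)) n =
      (n, walk x n, ∏ j ∈ Finset.range n, toSign (x j)) := by
  induction n with
  | zero => simp [orbit, walk]
  | succ n ih =>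
    simp only [orbit, ih, signStep, walk_succ, ← Finset.prod_range_succ, Units.coe_prod,
      coe_toSign (hx _)]

theorem orbit_bitStep (x y : ℕ → ℤ) (hx : ∀ j, x j = 1 ∨ x j = -1) (hy : ∀ j, y j = 1 ∨ y j = -1)
    (n : ℕ) :
    orbit bitStep (0, 0, 1, 1) (fun j => (toSign (x j), toSign (y j))) n =
      (walk x n, walk y n, ∏ j ∈ Finset.range n, toSign (x j),
        ∏ j ∈ Finset.range n, toSign (y j)) := by
  induction n with
  | zero => simp [orbit, walk]
  | succ n ih =>
    simp only [orbit, ih, bitStep, walk_succ, ← Finset.prod_range_succ, Units.coe_prod,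
      coe_toSign (hx _), coe_toSign (hy _)]

variable {Ω : Type*} [MeasurableSpace Ω] {P : Measure Ω} [IsProbabilityMeasure P]

theorem measurable_toSign : Measurable toSign := measurable_from_top

theorem IsFairSign.ae_eq {ξ : Ω → ℤ} (h : IsFairSign ξ P) : ∀ᵐ ω ∂P, ξ ω = 1 ∨ ξ ω = -1 := by
  have h1 : MeasurableSet {ω | ξ ω = 1} := h.measurable (measurableSet_singleton 1)
  have h2 : MeasurableSet {ω | ξ ω = -1} := h.measurable (measurableSet_singleton (-1))
  have hd : Disjoint {ω | ξ ω = 1} {ω | ξ ω = -1} := by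
    rw [Set.disjoint_left]
    intro ω (e1 : ξ ω = 1) (e2 : ξ ω = -1)
    omega
  have : P ({ω | ξ ω = 1} ∪ {ω | ξ ω = -1}) = 1 := by
    rw [measure_union hd h2, h.prob_one, h.prob_neg_one, ENNReal.add_halves]
  exact (prob_compl_eq_zero_iff (h1.union h2)).2 this

theorem IsFairSign.measure_toSign {ξ : Ω → ℤ} (h : IsFairSign ξ P) (e : ℤˣ) :
    P ((fun ω => toSign (ξ ω)) ⁻¹' {e}) = 1 / 2 := by
  rcases Int.units_eq_one_or e with rfl | rfl
  · rw [← h.prob_one]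
    refine measure_congr ?_
    filter_upwards [h.ae_eq] with ω hω
    refine propext ?_
    change toSign (ξ ω) = 1 ↔ ξ ω = 1
    rcases hω with hω | hω <;> simp [toSign, hω]
  · rw [← h.prob_neg_one]
    refine measure_congr ?_
    filter_upwards [h.ae_eq] with ω hω
    refine propext ?_
    change toSign (ξ ω) = -1 ↔ ξ ω = -1
    rcases hω with hω | hω <;> simp [toSign, hω]

end Sign

/-! ### Survival of the static walk. -/

section Static

variable {Ω : Type*} [MeasurableSpace Ω] {P : Measure Ω} [IsProbabilityMeasure P]

/-- The static walk stays above `i ^ α` for `n` steps with probability of order at least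
`1 / √n`. -/
theorem exists_le_measure_aboveEvent {X : ℕ → Ω → ℤ} (hX : IsFairSignSequence X P) {α : ℝ}
    (h0 : 0 ≤ α) (h1 : α < 1 / 2) :
    ∃ c : ℝ, 0 < c ∧ ∀ n : ℕ, ENNReal.ofReal (c / √((n : ℝ) + 1)) ≤ P (aboveEvent α n X) := by
  obtain ⟨c, hc, h⟩ := exists_le_signWalk_survive h0 h1
  refine ⟨c, hc, fun n => (ENNReal.ofReal_le_ofReal (h n)).trans ?_⟩
  have hcomap : ∀ j, MeasurableSpace.comap (fun ω => toSign (X j ω)) inferInstance ≤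
      MeasurableSpace.comap (X j) inferInstance := fun j => by
    exact (measurable_toSign.comp (comap_measurable (X j))).comap_le
  rw [← measure_orbit (P := P) (ζ := fun j ω => toSign (X j ω)) half_nonneg signStep _
    (fun j => measurable_toSign.comp (hX.sign j).measurable) (fun n => ?_) (fun j e => ?_)]
  · refine measure_mono_ae ?_
    filter_upwards [ae_all_iff.2 fun j => (hX.sign j).ae_eq] with ω hω
    intro hsurv i hi1 hi2
    have := (hsurv i hi1 hi2).2
    rwa [orbit_signStep _ hω] at this
  · have hd : Disjoint (Set.Iio n) {n} := by simp
    have := indep_iSup_of_disjoint (fun j => (hX.sign j).measurable.comap_le) hX.indep.iIndep hd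
    refine indep_of_indep_of_le this (iSup₂_mono fun j _ => hcomap j) ?_
    exact (hcomap n).trans
      (le_biSup (fun j => MeasurableSpace.comap (X j) inferInstance) (Set.mem_singleton n))
  · rw [(hX.sign j).measure_toSign]
    simp

end Static

/-! ### Two-time correlations of the dynamical walk. -/

section Dynamic

variable {Ω : Type*}

theorem measurable_bit {m : MeasurableSpace Ω} {N : ℕ → ℝ≥0 → Ω → ℕ} {ξ : ℕ → ℕ → Ω → ℤ} {j : ℕ}
    {t : ℝ≥0} (hN : Measurable (N j t)) (hξ : ∀ i, Measurable (ξ j i)) :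
    Measurable (bit N ξ j t) := by
  have h : Measurable fun p : Ω × ℕ => ξ j p.2 p.1 :=
    measurable_from_prod_countable_left fun i => hξ i
  exact h.comp (measurable_id.prodMk hN)

variable [MeasurableSpace Ω] {P : Measure Ω}

theorem measure_inter_preimage_of_fiber {ι : Type*} [Countable ι] [MeasurableSpace ι]
    [MeasurableSingletonClass ι] {κ : Ω → ι} (hκ : Measurable κ) {E : Set Ω} (hE : MeasurableSet E)
    (B : Set ι) {c : ℝ≥0∞} (h : ∀ i ∈ B, P (E ∩ κ ⁻¹' {i}) = c * P (κ ⁻¹' {i})) :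
    P (E ∩ κ ⁻¹' B) = c * P (κ ⁻¹' B) := by
  have hB : κ ⁻¹' B = ⋃ i ∈ B, κ ⁻¹' {i} := by ext; simp
  have hd : B.PairwiseDisjoint fun i => κ ⁻¹' {i} := fun i _ j _ hij =>
    Disjoint.preimage κ (by simpa using hij)
  rw [hB, Set.inter_iUnion₂, measure_biUnion (Set.to_countable B)
    (fun i hi j hj hij => (hd hi hj hij).mono Set.inter_subset_right Set.inter_subset_right)
    (fun i _ => hE.inter (hκ (measurableSet_singleton i))),
    measure_biUnion (Set.to_countable B) hd (fun i _ => hκ (measurableSet_singleton i)),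
    ← ENNReal.tsum_mul_left]
  exact tsum_congr fun i => h i i.2

variable {N : ℕ → ℝ≥0 → Ω → ℕ} {ξ : ℕ → ℕ → Ω → ℤ}

/-- The σ-algebras of the building blocks of the dynamics. -/
abbrev blocks (N : ℕ → ℝ≥0 → Ω → ℕ) (ξ : ℕ → ℕ → Ω → ℤ) : ℕ ⊕ ℕ × ℕ → MeasurableSpace Ω :=
  Sum.elim
    (fun j : ℕ => MeasurableSpace.comap (fun ω t => N j t ω) inferInstance)
    (fun p : ℕ × ℕ => MeasurableSpace.comap (ξ p.1 p.2) inferInstance)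

theorem IsDynamics.blocks_le (h : IsDynamics N ξ P) (i : ℕ ⊕ ℕ × ℕ) :
    blocks N ξ i ≤ ‹MeasurableSpace Ω› := by
  rcases i with j | p
  · exact (measurable_pi_lambda _ fun t => (h.poisson j).measurable t).comap_le
  · exact (h.sign p.1 p.2).measurable.comap_le

/-- The pair of bits at two times. -/
def bitPair (N : ℕ → ℝ≥0 → Ω → ℕ) (ξ : ℕ → ℕ → Ω → ℤ) (s t : ℝ≥0) (j : ℕ) (ω : Ω) : ℤˣ × ℤˣ :=
  (toSign (bit N ξ j s ω), toSign (bit N ξ j t ω))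

theorem comap_bitPair_le {Ω : Type*} {N : ℕ → ℝ≥0 → Ω → ℕ} {ξ : ℕ → ℕ → Ω → ℤ} (s t : ℝ≥0) (j : ℕ) {T : Set (ℕ ⊕ ℕ × ℕ)}
    (hT : {i | i.elim id Prod.fst = j} ⊆ T) :
    MeasurableSpace.comap (bitPair N ξ s t j) inferInstance ≤ ⨆ i ∈ T, blocks N ξ i := by
  have hN : ∀ t, Measurable[⨆ i ∈ T, blocks N ξ i] (N j t) := fun t => by
    have h1 : Measurable[blocks N ξ (Sum.inl j)] fun ω t => N j t ω :=
      comap_measurable _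
    exact ((measurable_pi_apply t).comp h1).mono
      (le_biSup (blocks N ξ) (hT (show (Sum.inl j : ℕ ⊕ ℕ × ℕ).elim id Prod.fst = j from rfl)))
      le_rfl
  have hξ : ∀ i, Measurable[⨆ i ∈ T, blocks N ξ i] (ξ j i) := fun i => by
    have h1 : Measurable[blocks N ξ (Sum.inr (j, i))] (ξ j i) := comap_measurable _
    exact h1.mono
      (le_biSup (blocks N ξ) (hT (show (Sum.inr (j, i) : ℕ ⊕ ℕ × ℕ).elim id Prod.fst = j from rfl)))
      le_rfl
  refine Measurable.comap_le ?_
  exact (measurable_toSign.comp (measurable_bit (hN s) hξ)).prodMk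
    (measurable_toSign.comp (measurable_bit (hN t) hξ))

theorem IsDynamics.indep_past_bitPair (h : IsDynamics N ξ P) (s t : ℝ≥0) (n : ℕ) :
    Indep (past (bitPair N ξ s t) n)
      (MeasurableSpace.comap (bitPair N ξ s t n) inferInstance) P := by
  have hd : Disjoint {i : ℕ ⊕ ℕ × ℕ | i.elim id Prod.fst < n} {i | i.elim id Prod.fst = n} := by
    rw [Set.disjoint_left]
    intro i (h1 : _ < n) (h2 : _ = n)
    omega
  refine indep_of_indep_of_le (indep_iSup_of_disjoint h.blocks_le h.indep hd)
    (iSup₂_le fun j hj => comap_bitPair_le s t j ?_) (comap_bitPair_le s t n subset_rfl)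
  intro i (hi : _ = j)
  exact hi.trans_lt hj

theorem IsPoissonProcess.measure_eq {M : ℝ≥0 → Ω → ℕ} (h : IsPoissonProcess M P) {s t : ℝ≥0}
    (hst : s ≤ t) : P {ω | M s ω = M t ω} = ENNReal.ofReal (Real.exp (-(t - s : ℝ))) := by
  have h1 := congrArg (fun μ => μ {0}) (h.law s t hst)
  have hm : Measurable fun ω => M t ω - M s ω := (h.measurable t).sub (h.measurable s)
  simp only [poissonMeasure_singleton] at h1
  rw [Measure.map_apply hm (measurableSet_singleton 0)] at h1
  have h2 : P {ω | M s ω = M t ω} = P ((fun ω => M t ω - M s ω) ⁻¹' {0}) := by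
    refine measure_congr ?_
    -- Subtraction in `ℕ` is truncated; monotonicity is what makes a zero difference mean equality.
    filter_upwards [h.monotone] with ω hω
    have := hω hst
    refine propext ?_
    change M s ω = M t ω ↔ M t ω - M s ω = 0
    simp only at this
    omega
  rw [h2, h1, NNReal.coe_sub hst]
  simp

theorem IsDynamics.measurable_bitPair (h : IsDynamics N ξ P) (s t : ℝ≥0) (j : ℕ) :
    Measurable (bitPair N ξ s t j) :=
  (measurable_toSign.comp
      (measurable_bit ((h.poisson j).measurable s) fun i => (h.sign j i).measurable)).prodMk
    (measurable_toSign.comp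
      (measurable_bit ((h.poisson j).measurable t) fun i => (h.sign j i).measurable))

variable [IsProbabilityMeasure P]

theorem IsDynamics.measure_signs_inter (h : IsDynamics N ξ P) (j k l : ℕ) (s t : ℝ≥0) (a b : ℤˣ) :
    P (((fun ω => toSign (ξ j k ω)) ⁻¹' {a} ∩ (fun ω => toSign (ξ j l ω)) ⁻¹' {b}) ∩
        (fun ω => (N j s ω, N j t ω)) ⁻¹' {(k, l)}) =
      (if k = l then if a = b then 1 / 2 else 0 else 1 / 4) *
        P ((fun ω => (N j s ω, N j t ω)) ⁻¹' {(k, l)}) := by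
  have hm : ∀ i (e : ℤˣ), MeasurableSet[blocks N ξ (Sum.inr (j, i))]
      ((fun ω => toSign (ξ j i ω)) ⁻¹' {e}) := fun i e =>
    ⟨toSign ⁻¹' {e}, measurable_toSign (measurableSet_singleton e), rfl⟩
  have hd : Disjoint (Set.range (Sum.inr : ℕ × ℕ → ℕ ⊕ ℕ × ℕ)) {Sum.inl j} := by simp
  have hind := indep_iSup_of_disjoint h.blocks_le h.indep hd
  have hle : ∀ p, blocks N ξ (Sum.inr p) ≤
      ⨆ i ∈ Set.range (Sum.inr : ℕ × ℕ → ℕ ⊕ ℕ × ℕ), blocks N ξ i := fun p =>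
    le_biSup (blocks N ξ) ⟨p, rfl⟩
  rw [(Indep_iff _ _ _).1 hind]
  · congr 1
    by_cases hkl : k = l
    · subst hkl
      by_cases hab : a = b
      · simp [hab, (h.sign j k).measure_toSign]
      · have : (fun ω => toSign (ξ j k ω)) ⁻¹' {a} ∩ (fun ω => toSign (ξ j k ω)) ⁻¹' {b} = ∅ := by
          rw [← Set.preimage_inter, Set.singleton_inter_eq_empty.2 (by simpa using hab)]
          rfl
        simp [hab, this]
    · have h2 := h.indep.indep (i := Sum.inr (j, k)) (j := Sum.inr (j, l)) (by simpa using hkl)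
      rw [(Indep_iff _ _ _).1 h2 _ _ (hm k a) (hm l b), (h.sign j k).measure_toSign,
        (h.sign j l).measure_toSign, if_neg hkl, one_div, one_div,
        ← ENNReal.mul_inv (by simp) (by simp)]
      norm_num
  · exact (hle _ _ (hm k a)).inter (hle _ _ (hm l b))
  · have h1 : Measurable[blocks N ξ (Sum.inl j)] fun ω t => N j t ω := comap_measurable _
    have h2 : Measurable[blocks N ξ (Sum.inl j)] fun ω => (N j s ω, N j t ω) :=
      ((measurable_pi_apply s).comp h1).prodMk ((measurable_pi_apply t).comp h1)
    exact le_biSup (blocks N ξ) (Set.mem_singleton (Sum.inl j)) _ (h2 (measurableSet_singleton _))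

/-- Condition on the pair of clock values. Equal values, of probability `ρ = e^{-(t-s)}`, give the
same sign; different values give independent signs. So the bits differ with probability `(1 - ρ)/2`.
-/
theorem IsDynamics.measure_bitPair (h : IsDynamics N ξ P) {s t : ℝ≥0} (hst : s ≤ t) (j : ℕ)
    (e : ℤˣ × ℤˣ) :
    P (bitPair N ξ s t j ⁻¹' {e}) =
      ENNReal.ofReal (bitWeight ((1 - Real.exp (-(t - s : ℝ))) / 2) e) := by
  obtain ⟨a, b⟩ := e
  set κ : Ω → ℕ × ℕ := fun ω => (N j s ω, N j t ω) with hκdef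
  have hκ : Measurable κ := ((h.poisson j).measurable s).prodMk ((h.poisson j).measurable t)
  set E := bitPair N ξ s t j ⁻¹' {(a, b)} with hE
  have hEm : MeasurableSet E := h.measurable_bitPair s t j (measurableSet_singleton _)
  have hfib : ∀ i : ℕ × ℕ, P (E ∩ κ ⁻¹' {i}) =
      (if i.1 = i.2 then if a = b then 1 / 2 else 0 else 1 / 4) * P (κ ⁻¹' {i}) := by
    rintro ⟨k, l⟩
    rw [← h.measure_signs_inter j k l s t a b]
    congr 1
    ext ω
    simp only [hE, hκdef, Set.mem_inter_iff, Set.mem_preimage, Set.mem_singleton_iff, bitPair,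
      Prod.mk.injEq, bit]
    constructor
    · rintro ⟨⟨h1, h2⟩, h3, h4⟩
      exact ⟨⟨h3 ▸ h1, h4 ▸ h2⟩, h3, h4⟩
    · rintro ⟨⟨h1, h2⟩, h3, h4⟩
      exact ⟨⟨h3 ▸ h1, h4 ▸ h2⟩, h3, h4⟩
  set B : Set (ℕ × ℕ) := {i | i.1 = i.2} with hB
  have hBm : MeasurableSet (κ ⁻¹' B) := hκ (Set.to_countable B).measurableSet
  have e1 := measure_inter_preimage_of_fiber (P := P) hκ hEm B (c := if a = b then 1 / 2 else 0)
    fun i (hi : i.1 = i.2) => by rw [hfib i, if_pos hi]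
  have e2 := measure_inter_preimage_of_fiber (P := P) hκ hEm Bᶜ (c := 1 / 4)
    fun i (hi : ¬ i.1 = i.2) => by rw [hfib i, if_neg hi]
  have e3 : P (κ ⁻¹' B) = ENNReal.ofReal (Real.exp (-(t - s : ℝ))) := (h.poisson j).measure_eq hst
  set ρ := Real.exp (-(t - s : ℝ)) with hρ
  have hρ0 : 0 < ρ := Real.exp_pos _
  have hρ1 : ρ ≤ 1 := Real.exp_le_one_iff.2 (by
    have : (s : ℝ) ≤ t := by exact_mod_cast hst
    linarith)
  rw [Set.preimage_compl, prob_compl_eq_one_sub hBm, e3] at e2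
  rw [e3] at e1
  rw [← measure_inter_add_sdiff E hBm, e1, Set.sdiff_eq, e2, ← ENNReal.ofReal_one,
    ← ENNReal.ofReal_sub _ hρ0.le, show ENNReal.ofReal 1 / 4 = ENNReal.ofReal (1 / 4) by
      rw [ENNReal.ofReal_div_of_pos (by norm_num)]; simp,
    ← ENNReal.ofReal_mul (by norm_num)]
  by_cases hab : a = b
  · simp only [hab, if_true, bitWeight]
    rw [show ENNReal.ofReal 1 / 2 = ENNReal.ofReal (1 / 2) by
      rw [ENNReal.ofReal_div_of_pos (by norm_num)]; simp,
      ← ENNReal.ofReal_mul (by norm_num), ← ENNReal.ofReal_add (by positivity) (by linarith)]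
    congr 1
    ring
  · simp only [hab, if_false, bitWeight, zero_mul, zero_add]
    congr 1
    ring

theorem le_one_sub_exp_neg {u : ℝ} (h0 : 0 ≤ u) (h1 : u ≤ 1) : u / 2 ≤ 1 - Real.exp (-u) := by
  have h2 : Real.exp (-u) ≤ 1 / (1 + u) := by
    rw [Real.exp_neg, inv_eq_one_div]
    exact one_div_le_one_div_of_le (by linarith) (by linarith [Real.add_one_le_exp u])
  have h3 : 1 / (1 + u) ≤ 1 - u / 2 := by
    rw [div_le_iff₀ (by linarith)]; nlinarith
  linarith

/-- The correlation bound for the dynamical walk at two times. -/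
theorem IsDynamics.measure_dynAboveEvent_inter_le (h : IsDynamics N ξ P) (α : ℝ) (n : ℕ)
    {s t : ℝ≥0} (hst : s < t) (ht : t ≤ 1) :
    P (dynAboveEvent α n N ξ s ∩ dynAboveEvent α n N ξ t) ≤
      ENNReal.ofReal (20480 / (√(t - s : ℝ) * (n + 1))) := by
  have hst' : (s : ℝ) < t := by exact_mod_cast hst
  have ht' : (t : ℝ) ≤ 1 := by exact_mod_cast ht
  set u : ℝ := t - s with hu
  have hu0 : 0 < u := by linarith
  have hu1 : u ≤ 1 := by linarith [s.coe_nonneg]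
  set q := (1 - Real.exp (-u)) / 2 with hq
  have hqu : u / 4 ≤ q := by rw [hq]; linarith [le_one_sub_exp_neg hu0.le hu1]
  have hq0 : 0 < q := by linarith
  have hq1 : q ≤ 1 / 2 := by rw [hq]; linarith [Real.exp_pos (-u)]
  have hw : ∀ e, 0 ≤ bitWeight q e := fun e => by unfold bitWeight; split_ifs <;> linarith
  have hbound : (killed (bitWeight q) bitStep {x | 0 < x.1 ∧ 0 < x.2.1} ^ n) 1 (0, 0, 1, 1) ≤
      20480 / (√u * (n + 1)) := by
    refine (bitWalk_survive_le hq0 hq1 n).trans ?_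
    have hs : √u / 2 ≤ √q := by
      refine Real.le_sqrt_of_sq_le ?_
      rw [div_pow, Real.sq_sqrt hu0.le]
      linarith
    have hs0 : 0 < √u := Real.sqrt_pos.2 hu0
    calc 10240 / (√q * ((n : ℝ) + 1)) ≤ 10240 / (√u / 2 * (n + 1)) := by gcongr
      _ = _ := by field_simp; norm_num
  refine le_trans ?_ (ENNReal.ofReal_le_ofReal hbound)
  rw [← measure_orbit hw bitStep _ (h.measurable_bitPair s t) (h.indep_past_bitPair s t)
    (h.measure_bitPair hst.le)]
  refine measure_mono_ae ?_
  filter_upwards [ae_all_iff.2 fun j => ae_all_iff.2 fun i => (h.sign j i).ae_eq] with ω hω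
  rintro ⟨hs, ht⟩ i hi1 hi2
  -- Only positivity of both walks is kept from the curve condition; `i ≥ 1` is needed here.
  have hpos : (0 : ℝ) < (i : ℝ) ^ α := Real.rpow_pos_of_pos (by exact_mod_cast hi1) α
  change orbit bitStep (0, 0, 1, 1)
    (fun j => (toSign (bit N ξ j s ω), toSign (bit N ξ j t ω))) i ∈
      {x : ℤ × ℤ × ℤˣ × ℤˣ | 0 < x.1 ∧ 0 < x.2.1}
  rw [orbit_bitStep (fun j => bit N ξ j s ω) (fun j => bit N ξ j t ω)
    (fun j => hω j _) (fun j => hω j _)]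
  have e1 := hpos.trans_le (hs i hi1 hi2)
  have e2 := hpos.trans_le (ht i hi1 hi2)
  exact ⟨by exact_mod_cast e1, by exact_mod_cast e2⟩

end Dynamic

/-! ### Joint measurability in `ω` and time. -/

section Measurability

variable {Ω : Type*} [MeasurableSpace Ω] {P : Measure Ω}

open Filter Topology in
/-- A right-continuous integer-valued process is jointly measurable. -/
theorem measurable_uncurry_of_rightCont {M : ℝ≥0 → Ω → ℕ} (hM : ∀ t, Measurable (M t))
    (hc : ∀ ω t, ContinuousWithinAt (fun s => M s ω) (Set.Ici t) t) :
    Measurable fun p : Ω × ℝ≥0 => M p.2 p.1 := by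
  -- Grid points strictly above `t` and within `1/(k+1)` of it, so that right continuity applies.
  let r : ℕ → ℝ≥0 → ℝ≥0 := fun k t => (⌊t * (k + 1)⌋₊ + 1) / (k + 1)
  have hr : ∀ t, Tendsto (fun k => r k t) atTop (𝓝[Set.Ici t] t) := by
    intro t
    have h1 : ∀ k, t ≤ r k t := fun k => by
      rw [le_div_iff₀ (by positivity)]
      exact (Nat.lt_floor_add_one _).le
    have h2 : ∀ k : ℕ, r k t ≤ t + 1 / ((k : ℝ≥0) + 1) := fun k => by
      have : t + 1 / ((k : ℝ≥0) + 1) = (t * (k + 1) + 1) / (k + 1) := by field_simp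
      rw [this]
      simp only [r]
      gcongr
      exact Nat.floor_le zero_le
    refine tendsto_nhdsWithin_iff.2 ⟨?_, Eventually.of_forall h1⟩
    refine tendsto_of_tendsto_of_tendsto_of_le_of_le tendsto_const_nhds ?_ h1 h2
    simpa using (tendsto_const_nhds (x := t)).add
      (tendsto_one_div_add_atTop_nhds_zero_nat (𝕜 := ℝ≥0))
  refine measurable_of_tendsto_metrizable (f := fun k (p : Ω × ℝ≥0) => M (r k p.2) p.1)
    (fun k => ?_) ?_
  · have h : Measurable fun p : Ω × ℕ => M ((p.2 + 1) / (k + 1)) p.1 :=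
      measurable_from_prod_countable_left fun i => hM ((i + 1) / (k + 1))
    have h2 : Measurable fun p : Ω × ℝ≥0 => (p.1, ⌊p.2 * ((k : ℝ≥0) + 1)⌋₊) :=
      measurable_fst.prodMk (Nat.measurable_floor.comp (measurable_snd.mul_const _))
    have h3 := h.comp h2
    simpa only [Function.comp_def] using h3
  · exact tendsto_pi_nhds.2 fun p => (hc p.1 p.2).tendsto.comp (hr p.2)

/-- Paths are right-continuous only almost surely; setting the clocks to `0` on a measurable null
set containing the bad paths gives right continuity everywhere, hence joint measurability for
Tonelli. -/
theorem IsDynamics.exists_measurable_modification {N : ℕ → ℝ≥0 → Ω → ℕ} {ξ : ℕ → ℕ → Ω → ℤ}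
    (h : IsDynamics N ξ P) :
    ∃ N' : ℕ → ℝ≥0 → Ω → ℕ, (∀ j, Measurable fun p : Ω × ℝ≥0 => N' j p.2 p.1) ∧
      ∀ᵐ ω ∂P, ∀ j t, N' j t ω = N j t ω := by
  classical
  have hae := ae_all_iff.2 fun j => (h.poisson j).rightCont
  obtain ⟨T, hT, hTm, hT0⟩ := exists_measurable_superset_of_null (ae_iff.1 hae)
  refine ⟨fun j t ω => if ω ∈ T then 0 else N j t ω, fun j => ?_, ?_⟩
  · refine measurable_uncurry_of_rightCont (M := fun t ω => if ω ∈ T then 0 else N j t ω)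
      (fun t => Measurable.ite hTm measurable_const ((h.poisson j).measurable t)) fun ω t => ?_
    by_cases hω : ω ∈ T
    · simpa [hω] using continuousWithinAt_const
    · have := not_not.1 fun h' => hω (hT h')
      simpa [hω] using this j t
  · filter_upwards [measure_eq_zero_iff_ae_notMem.1 hT0] with ω hω j t
    rw [if_neg hω]

theorem measurableSet_dynAboveEvent {N : ℕ → ℝ≥0 → Ω → ℕ} {ξ : ℕ → ℕ → Ω → ℤ}
    (hN : ∀ j, Measurable fun p : Ω × ℝ≥0 => N j p.2 p.1) (hξ : ∀ j i, Measurable (ξ j i))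
    (α : ℝ) (n : ℕ) : MeasurableSet {p : Ω × ℝ≥0 | p.1 ∈ dynAboveEvent α n N ξ p.2} := by
  have hbit : ∀ j, Measurable fun p : Ω × ℝ≥0 => bit N ξ j p.2 p.1 := fun j => by
    have h : Measurable fun p : Ω × ℕ => ξ j p.2 p.1 :=
      measurable_from_prod_countable_left fun i => hξ j i
    exact h.comp (measurable_fst.prodMk (hN j))
  have hwalk : ∀ i, Measurable fun p : Ω × ℝ≥0 => walk (fun j => bit N ξ j p.2 p.1) i := fun i =>
    Finset.measurable_fun_sum _ fun k _ => Finset.measurable_fun_prod _ fun j _ => hbit j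
  have : {p : Ω × ℝ≥0 | p.1 ∈ dynAboveEvent α n N ξ p.2} = ⋂ i ∈ Set.Icc 1 n,
      {p : Ω × ℝ≥0 | (i : ℝ) ^ α ≤ (walk (fun j => bit N ξ j p.2 p.1) i : ℝ)} := by
    ext p; simp [dynAboveEvent, aboveEvent]
  rw [this]
  exact MeasurableSet.biInter (Set.to_countable _) fun i _ =>
    measurableSet_le measurable_const (measurable_from_top.comp (hwalk i))

/-- The integrand of the energy. -/
noncomputable def energyKernel (α γ : ℝ) (n : ℕ) (N : ℕ → ℝ≥0 → Ω → ℕ) (ξ : ℕ → ℕ → Ω → ℤ) (ω : Ω)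
    (t s : ℝ) : ℝ≥0∞ :=
  (dynAboveEvent α n N ξ s.toNNReal ∩ dynAboveEvent α n N ξ t.toNNReal).indicator 1 ω /
    ENNReal.ofReal |t - s| ^ γ

theorem measurable_energyKernel {N : ℕ → ℝ≥0 → Ω → ℕ} {ξ : ℕ → ℕ → Ω → ℤ}
    (hN : ∀ j, Measurable fun p : Ω × ℝ≥0 => N j p.2 p.1) (hξ : ∀ j i, Measurable (ξ j i))
    (α γ : ℝ) (n : ℕ) :
    Measurable fun p : (Ω × ℝ) × ℝ => energyKernel α γ n N ξ p.1.1 p.1.2 p.2 := by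
  have hset := measurableSet_dynAboveEvent hN hξ α n
  have h1 : Measurable fun p : (Ω × ℝ) × ℝ => (p.1.1, p.2.toNNReal) := by fun_prop
  have h2 : Measurable fun p : (Ω × ℝ) × ℝ => (p.1.1, p.1.2.toNNReal) := by fun_prop
  refine Measurable.div ?_ ?_
  · exact measurable_one.indicator ((h1 hset).inter (h2 hset))
  · have : Measurable fun p : (Ω × ℝ) × ℝ => |p.1.2 - p.2| := by fun_prop
    exact this.ennreal_ofReal.pow_const γ

theorem energyKernel_congr {Ω : Type*} {N N' : ℕ → ℝ≥0 → Ω → ℕ} {ξ : ℕ → ℕ → Ω → ℤ} {ω : Ω}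
    (h : ∀ j t, N' j t ω = N j t ω) (α γ : ℝ) (n : ℕ) (t s : ℝ) :
    energyKernel α γ n N ξ ω t s = energyKernel α γ n N' ξ ω t s := by
  have : ∀ t, ω ∈ dynAboveEvent α n N ξ t ↔ ω ∈ dynAboveEvent α n N' ξ t := fun t => by
    simp [dynAboveEvent, aboveEvent, bit, h]
  have hset : ω ∈ dynAboveEvent α n N ξ s.toNNReal ∩ dynAboveEvent α n N ξ t.toNNReal ↔
      ω ∈ dynAboveEvent α n N' ξ s.toNNReal ∩ dynAboveEvent α n N' ξ t.toNNReal := and_congr (this s.toNNReal) (this t.toNNReal)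
  rw [energyKernel, energyKernel]
  congr 1
  by_cases hω : ω ∈ dynAboveEvent α n N ξ s.toNNReal ∩ dynAboveEvent α n N ξ t.toNNReal
  · rw [Set.indicator_of_mem hω, Set.indicator_of_mem (hset.1 hω)]
  · rw [Set.indicator_of_notMem hω, Set.indicator_of_notMem fun h' => hω (hset.2 h')]

end Measurability

/-! ### Integrability of the singular kernel. -/

section Integrals

open Set in
theorem lintegral_abs_rpow_lt_top {β : ℝ} (hβ : β < 1) :
    ∫⁻ v in Icc (-1 : ℝ) 1, ENNReal.ofReal (|v| ^ (-β)) < ∞ := by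
  have h1 : IntervalIntegrable (fun v : ℝ => |v| ^ (-β)) volume 0 1 := by
    refine (intervalIntegral.intervalIntegrable_rpow' (show -1 < -β by linarith)).congr ?_
    intro v hv
    rw [uIoc_of_le zero_le_one] at hv
    simp only [abs_of_pos hv.1]
  have h2 : IntervalIntegrable (fun v : ℝ => |v| ^ (-β)) volume (-1) 0 := by
    have := h1.symm.comp_sub_left 0
    simpa using this
  have h3 := (intervalIntegrable_iff_integrableOn_Icc_of_le (by norm_num)).1 (h2.trans h1)
  refine lt_of_le_of_lt (lintegral_mono fun v => ?_) h3.2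
  rw [← ofReal_norm]
  exact ENNReal.ofReal_le_ofReal (le_abs_self _)

open Set in
theorem lintegral_abs_sub_rpow_le (β : ℝ) {t : ℝ} (ht : t ∈ Icc (0 : ℝ) 1) :
    ∫⁻ s in Icc (0 : ℝ) 1, ENNReal.ofReal (|t - s| ^ (-β)) ≤
      ∫⁻ v in Icc (-1 : ℝ) 1, ENNReal.ofReal (|v| ^ (-β)) := by
  rw [← lintegral_indicator measurableSet_Icc, ← lintegral_indicator measurableSet_Icc,
    ← lintegral_sub_left_eq_self (indicator (Icc (-1) 1) _) t]
  refine lintegral_mono fun s => ?_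
  by_cases hs : s ∈ Icc (0 : ℝ) 1
  swap
  · simp [hs]
  rw [indicator_of_mem hs]
  have : t - s ∈ Icc (-1 : ℝ) 1 := ⟨by linarith [ht.1, hs.2], by linarith [ht.2, hs.1]⟩
  rw [indicator_of_mem this]

end Integrals

/-! ### Expectation of the energy. -/

section Energy

variable {Ω : Type*} [MeasurableSpace Ω] {P : Measure Ω} [IsProbabilityMeasure P]
  {N : ℕ → ℝ≥0 → Ω → ℕ} {ξ : ℕ → ℕ → Ω → ℤ}

theorem IsDynamics.measure_inter_le_abs (h : IsDynamics N ξ P) (α : ℝ) (n : ℕ) {s t : ℝ}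
    (hs : s ∈ Set.Icc (0 : ℝ) 1) (ht : t ∈ Set.Icc (0 : ℝ) 1) (hst : s ≠ t) :
    P (dynAboveEvent α n N ξ s.toNNReal ∩ dynAboveEvent α n N ξ t.toNNReal) ≤
      ENNReal.ofReal (20480 / (√|t - s| * (n + 1))) := by
  rcases lt_or_gt_of_ne hst with h1 | h1
  · have := h.measure_dynAboveEvent_inter_le α n (s := s.toNNReal) (t := t.toNNReal)
      ((Real.toNNReal_lt_toNNReal_iff_of_nonneg hs.1).2 h1) (by simpa using ht.2)
    rwa [Real.coe_toNNReal _ hs.1, Real.coe_toNNReal _ ht.1, ← abs_of_pos (sub_pos.2 h1)] at this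
  · have := h.measure_dynAboveEvent_inter_le α n (s := t.toNNReal) (t := s.toNNReal)
      ((Real.toNNReal_lt_toNNReal_iff_of_nonneg ht.1).2 h1) (by simpa using hs.2)
    rwa [Real.coe_toNNReal _ hs.1, Real.coe_toNNReal _ ht.1, ← abs_of_pos (sub_pos.2 h1),
      abs_sub_comm, Set.inter_comm] at this

theorem IsDynamics.lintegral_energyKernel_le (h : IsDynamics N ξ P) (α γ : ℝ) (n : ℕ) {s t : ℝ}
    (hs : s ∈ Set.Icc (0 : ℝ) 1) (ht : t ∈ Set.Icc (0 : ℝ) 1) (hst : s ≠ t) :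
    ∫⁻ ω, energyKernel α γ n N ξ ω t s ∂P ≤
      ENNReal.ofReal (20480 / (n + 1)) * ENNReal.ofReal (|t - s| ^ (-(γ + 1 / 2))) := by
  have hpos : 0 < |t - s| := abs_pos.2 (sub_ne_zero.2 hst.symm)
  simp only [energyKernel, div_eq_mul_inv _ (ENNReal.ofReal _ ^ γ)]
  rw [lintegral_mul_const']
  · refine (mul_le_mul_left ((lintegral_indicator_one_le _).trans
      (h.measure_inter_le_abs α n hs ht hst)) _).trans (le_of_eq ?_)
    rw [ENNReal.ofReal_rpow_of_pos hpos, ← ENNReal.ofReal_inv_of_pos (by positivity),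
      ← ENNReal.ofReal_mul (by positivity), ← ENNReal.ofReal_mul (by positivity)]
    congr 1
    rw [neg_add, Real.rpow_add hpos, Real.rpow_neg hpos.le, Real.rpow_neg hpos.le,
      ← Real.sqrt_eq_rpow]
    field_simp
  · rw [ENNReal.ofReal_rpow_of_pos hpos]
    exact ENNReal.inv_ne_top.2 (by simpa using Real.rpow_pos_of_pos hpos γ)

/-- The expectation of the unnormalised energy is `O(1 / n)`. -/
theorem IsDynamics.lintegral_energy_le (h : IsDynamics N ξ P) (α γ : ℝ) (n : ℕ) :
    (AEMeasurable (fun ω => ∫⁻ t in Set.Icc (0 : ℝ) 1, ∫⁻ s in Set.Icc (0 : ℝ) 1,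
      energyKernel α γ n N ξ ω t s) P) ∧
    ∫⁻ ω, (∫⁻ t in Set.Icc (0 : ℝ) 1, ∫⁻ s in Set.Icc (0 : ℝ) 1,
      energyKernel α γ n N ξ ω t s) ∂P ≤ ENNReal.ofReal (20480 / (n + 1)) *
        ∫⁻ v in Set.Icc (-1 : ℝ) 1, ENNReal.ofReal (|v| ^ (-(γ + 1 / 2))) := by
  obtain ⟨N', hN', hNN'⟩ := h.exists_measurable_modification
  have hm := measurable_energyKernel hN' (fun j i => (h.sign j i).measurable) α γ n
  have hm1 : Measurable fun p : Ω × ℝ => ∫⁻ s in Set.Icc (0 : ℝ) 1,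
      energyKernel α γ n N' ξ p.1 p.2 s := hm.lintegral_prod_right'
  have hm2 : Measurable fun ω => ∫⁻ t in Set.Icc (0 : ℝ) 1, ∫⁻ s in Set.Icc (0 : ℝ) 1,
      energyKernel α γ n N' ξ ω t s := hm1.lintegral_prod_right'
  have hae : (fun ω => ∫⁻ t in Set.Icc (0 : ℝ) 1, ∫⁻ s in Set.Icc (0 : ℝ) 1,
      energyKernel α γ n N ξ ω t s) =ᵐ[P] fun ω => ∫⁻ t in Set.Icc (0 : ℝ) 1,
        ∫⁻ s in Set.Icc (0 : ℝ) 1, energyKernel α γ n N' ξ ω t s := by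
    filter_upwards [hNN'] with ω hω
    simp only [energyKernel_congr hω]
  refine ⟨⟨_, hm2, hae⟩, ?_⟩
  rw [lintegral_congr_ae hae, lintegral_lintegral_swap hm1.aemeasurable]
  have hbound : ∀ t ∈ Set.Icc (0 : ℝ) 1, ∫⁻ ω, (∫⁻ s in Set.Icc (0 : ℝ) 1,
      energyKernel α γ n N' ξ ω t s) ∂P ≤ ENNReal.ofReal (20480 / (n + 1)) *
        ∫⁻ v in Set.Icc (-1 : ℝ) 1, ENNReal.ofReal (|v| ^ (-(γ + 1 / 2))) := by
    intro t ht
    have hpair : Measurable fun p : Ω × ℝ => ((p.1, t), p.2) := by fun_prop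
    have hmt : Measurable fun p : Ω × ℝ => energyKernel α γ n N' ξ p.1 t p.2 :=
      by simpa only [Function.comp_def] using hm.comp hpair
    rw [lintegral_lintegral_swap hmt.aemeasurable]
    calc _ ≤ ∫⁻ s in Set.Icc (0 : ℝ) 1, ENNReal.ofReal (20480 / (n + 1)) *
          ENNReal.ofReal (|t - s| ^ (-(γ + 1 / 2))) := by
          refine lintegral_mono_ae ?_
          -- The correlation bound requires distinct times; the diagonal is null.
          have hne : ∀ᵐ s ∂(volume.restrict (Set.Icc (0 : ℝ) 1)), s ≠ t :=
            ae_restrict_of_ae (Measure.ae_ne volume t)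
          filter_upwards [ae_restrict_mem measurableSet_Icc, hne] with s hs hst
          refine le_trans (le_of_eq ?_) (h.lintegral_energyKernel_le α γ n hs ht hst)
          refine lintegral_congr_ae ?_
          filter_upwards [hNN'] with ω hω
          exact (energyKernel_congr hω α γ n t s).symm
      _ = ENNReal.ofReal (20480 / (n + 1)) * ∫⁻ s in Set.Icc (0 : ℝ) 1,
          ENNReal.ofReal (|t - s| ^ (-(γ + 1 / 2))) :=
          lintegral_const_mul' _ _ ENNReal.ofReal_ne_top
      _ ≤ _ := mul_le_mul' le_rfl (lintegral_abs_sub_rpow_le _ ht)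
  refine (setLIntegral_mono' measurableSet_Icc hbound).trans (le_of_eq ?_)
  rw [setLIntegral_const]
  simp

end Energy

end SwitchWalk

theorem mainTheorem3 {Ω : Type*} [MeasurableSpace Ω] (P : Measure Ω) [IsProbabilityMeasure P]
    (X : ℕ → Ω → ℤ) (hX : SwitchWalk.IsFairSignSequence X P)
    (N : ℕ → ℝ≥0 → Ω → ℕ) (ξ : ℕ → ℕ → Ω → ℤ) (hdyn : SwitchWalk.IsDynamics N ξ P)
    (α γ : ℝ) (hα : α ∈ Set.Ico (0 : ℝ) (1 / 2)) (hγ : γ ∈ Set.Ico (0 : ℝ) (1 / 2)) :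
    (∀ n : ℕ, AEMeasurable (SwitchWalk.energy α γ n X N ξ P) P) ∧
      (⨆ n : ℕ, ∫⁻ ω, SwitchWalk.energy α γ n X N ξ P ω ∂P) < ∞ := by
  refine ⟨fun n => (hdyn.lintegral_energy_le α γ n).1.const_mul _, ?_⟩
  obtain ⟨c, hc, hlow⟩ := SwitchWalk.exists_le_measure_aboveEvent hX hα.1 hα.2
  set J := ∫⁻ v in Set.Icc (-1 : ℝ) 1, ENNReal.ofReal (|v| ^ (-(γ + 1 / 2))) with hJ
  have hJtop : J < ∞ := SwitchWalk.lintegral_abs_rpow_lt_top (by linarith [hγ.2])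
  refine lt_of_le_of_lt (iSup_le fun n => ?_)
    (ENNReal.mul_lt_top (ENNReal.ofReal_lt_top (r := 20480 / c ^ 2)) hJtop)
  have hnorm : 1 / P (SwitchWalk.aboveEvent α n X) ^ 2 ≤ ENNReal.ofReal ((n + 1) / c ^ 2) := by
    calc 1 / P (SwitchWalk.aboveEvent α n X) ^ 2
        ≤ 1 / ENNReal.ofReal (c / √((n : ℝ) + 1)) ^ 2 := by
          gcongr
          exact hlow n
      _ = ENNReal.ofReal ((n + 1) / c ^ 2) := by
          rw [← ENNReal.ofReal_pow (by positivity), one_div,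
            ← ENNReal.ofReal_inv_of_pos (by positivity), div_pow, Real.sq_sqrt (by positivity),
            inv_div]
  calc ∫⁻ ω, SwitchWalk.energy α γ n X N ξ P ω ∂P
      = 1 / P (SwitchWalk.aboveEvent α n X) ^ 2 *
          ∫⁻ ω, (∫⁻ t in Set.Icc (0 : ℝ) 1, ∫⁻ s in Set.Icc (0 : ℝ) 1,
            SwitchWalk.energyKernel α γ n N ξ ω t s) ∂P :=
        lintegral_const_mul'' _ (hdyn.lintegral_energy_le α γ n).1
    _ ≤ ENNReal.ofReal ((n + 1) / c ^ 2) * (ENNReal.ofReal (20480 / (n + 1)) * J) :=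
        mul_le_mul' hnorm (hdyn.lintegral_energy_le α γ n).2
    _ = ENNReal.ofReal (20480 / c ^ 2) * J := by
        rw [← mul_assoc, ← ENNReal.ofReal_mul (by positivity)]
        congr 2
        field_simp
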